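/- Let $X$ be a complex manifold of dimension $n$ and let $E\to X$ be a holomorphic vector bundle of rank $r\ge 1$ with a smooth hermitian metric $h$. Write the Chern curvature tensor as $$\Theta_{E,h}=i\nabla_{E,h}^2=i\sum_{1\le j,k\le n,\;1\le\lambda,\mu\le r}c_{jk\lambda\mu}\,dz_j\wedge d\bar z_k\otimes e_\lambda^*\otimes e_\mu$$ in holomorphic coordinates $(z_j)$ of $X$ and an $h$-orthonormal frame $(e_\lambda)$ of $E$, and let $\Theta_{\det E,\det h}$ be the Chern curvature form of the line bundle $\det E=\Lambda^rE$ with the induced metric $\det h$. The tensor $\Theta_{E,h}$ is called * Nakano positive if $\sum c_{jk\lambda\mu}\gamma_{j\lambda}\overline{\gamma_{k\mu}}>0$ at every point for all $(\gamma_{j\lambda})\ne 0$; * dual Nakano positive if $\sum c_{jk\mu\lambda}\gamma_{j\lambda}\overline{\gamma_{k\mu}}>0$ at every point for all $(\gamma_{j\lambda})\ne 0$; * Griffiths positive if $\sum c_{jk\lambda\mu}\xi_j\overline{\xi_k}v_\lambda\overline{v_\mu}>0$ at every point for all $\xi\ne0$, $v\ne 0$. In these respective cases define the $(n,n)$-forms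 (independent of the choice of the coordinates and of the orthonormal frame) $$\Phi_N=\det(c_{jk\lambda\mu})_{(j,\lambda),(k,\mu)}^{1/r}\;i\,dz_1\wedge d\bar z_1\wedge\dots\wedge i\,dz_n\wedge d\bar z_n,$$ $$\Phi_{N^*}=\det(c_{jk\mu\lambda})_{(j,\lambda),(k,\mu)}^{1/r}\;i\,dz_1\wedge d\bar z_1\wedge\dots\wedge i\,dz_n\wedge d\bar z_n,$$ $$\Phi_G=\inf_{v\in E,\;|v|_h=1}\frac1{n!}\big(\langle\Theta_{E,h}\cdot v,v\rangle_h\big)^n .$$ Say that $(E,h)$ is projectively flat if $\Theta_{E,h}=\alpha\otimes\mathrm{Id}_E$ for some $(1,1)$-form $\alpha$ on $X$. Then: (a) If $\Theta_{E,h}$ is Nakano positive, then $\Phi_N\le\frac1{n!\,r^n}(\Theta_{\det E,\det h})^n$ at every point of $X$. (b) If $\Theta_{E,h}$ is dual Nakano positive, then $\Phi_{N^*}\le\frac1{n!\,r^n}(\Theta_{\det E,\det h})^n$ at every point of $X$. (c) If $\Theta_{E,h}$ is Griffiths positive, then $\Phi_G\le\frac1{n!\,r^n}(\Theta_{\det E,\det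 h})^n$ at every point of $X$. Moreover, in each of the three cases, $\Theta_{E,h}$ has the positivity property in question and the equality of volume forms holds on all of $X$ if and only if $(E,h)$ is projectively flat and $\Theta_{\det E,\det h}>0$ (as a $(1,1)$-form). -/

import Mathlib

open Bundle Manifold
open scoped ContDiff

noncomputable section

namespace ChernForms

/-- The model `ℂⁿ`, both for coordinates on the base and for the fibres of a vector bundle. -/
abbrev Cn (n : ℕ) : Type := EuclideanSpace ℂ (Fin n)

/-! ### Calculus on open subsets of `ℂⁿ` -/

section LocalCalculus

variable {n : ℕ}

/-- The Wirtinger derivative `∂f/∂z_j = (∂f/∂x_j - i ∂f/∂y_j) / 2`. -/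
def dbyZ (j : Fin n) (f : Cn n → ℂ) (z : Cn n) : ℂ :=
  (fderiv ℝ f z (EuclideanSpace.single j 1)
    - Complex.I * fderiv ℝ f z (EuclideanSpace.single j Complex.I)) / 2

/-- The Wirtinger derivative `∂f/∂z̄_j = (∂f/∂x_j + i ∂f/∂y_j) / 2`. -/
def dbyZbar (j : Fin n) (f : Cn n → ℂ) (z : Cn n) : ℂ :=
  (fderiv ℝ f z (EuclideanSpace.single j 1)
    + Complex.I * fderiv ℝ f z (EuclideanSpace.single j Complex.I)) / 2

/-- Let `H_{λμ} = ⟨e_λ, e_μ⟩` be the Gram matrix of a hermitian metric in a holomorphic frame.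
The Chern connection (compatible with the metric, with `(0,1)`-part `∂̄`) is
`∇ e_λ = ∑_μ A_{λμ} ⊗ e_μ`, where `A` is the matrix of `(1,0)`-forms determined by `∂H = A H`.
This is the `dz_j`-component of `A = ∂H ⬝ H⁻¹`. -/
def chernConnection {m : ℕ} (H : Cn n → Matrix (Fin m) (Fin m) ℂ) (j : Fin n) (z : Cn n) :
    Matrix (Fin m) (Fin m) ℂ :=
  (Matrix.of fun l k => dbyZ j (fun w => H w l k) z) * (H z)⁻¹

/-- The curvature `∇²` of the Chern connection is of type `(1,1)`, and equal to
`∂̄A = - ∑_{j,k} (∂A_j/∂z̄_k) dz_j ∧ dz̄_k`.  This is its coefficient of `dz_j ∧ dz̄_k`: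
`∇² e_λ = ∑_{j,k,μ} (chernCurvature H j k z)_{λμ} dz_j ∧ dz̄_k ⊗ e_μ`. -/
def chernCurvature {m : ℕ} (H : Cn n → Matrix (Fin m) (Fin m) ℂ) (j k : Fin n) (z : Cn n) :
    Matrix (Fin m) (Fin m) ℂ :=
  Matrix.of fun l p => -dbyZbar k (fun w => chernConnection H j w l p) z

end LocalCalculus

/-! ### Complex-valued differential forms at a point

The tangent space at `x` is Mathlib's `TangentSpace`, with the coordinates given by the
holomorphic chart at `x`.  Complex-valued forms at `x` are the elements of the exterior algebra
(over `ℂ`) of the space of real-linear maps `T_x X → ℂ`, with the wedge product as product. -/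

section Forms

variable {n : ℕ} {X : Type*} [TopologicalSpace X] [ChartedSpace (Cn n) X]

/-- The complexified cotangent space `T_x^*X ⊗ ℂ`. -/
abbrev CotangentC (x : X) : Type := TangentSpace 𝓘(ℂ, Cn n) x →ₗ[ℝ] ℂ

/-- The algebra of complex-valued alternating forms at the point `x`. -/
abbrev FormsAt (x : X) : Type := ExteriorAlgebra ℂ (CotangentC (n := n) x)

/-- The coordinate covector `dz_j`. -/
def dz (x : X) (j : Fin n) : CotangentC (n := n) x :=
  ((EuclideanSpace.proj j : Cn n →L[ℂ] ℂ) : Cn n →ₗ[ℂ] ℂ).restrictScalars ℝ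

/-- The coordinate covector `dz̄_j`. -/
def dzbar (x : X) (j : Fin n) : CotangentC (n := n) x :=
  Complex.conjAe.toLinearMap ∘ₗ dz x j

/-- The `(1,1)`-form `i ∑_{j,k} a_{jk} dz_j ∧ dz̄_k`. -/
def form11 (x : X) (a : Fin n → Fin n → ℂ) : FormsAt (n := n) x :=
  Complex.I • ∑ j, ∑ k, a j k • (ExteriorAlgebra.ι ℂ (dz x j) * ExteriorAlgebra.ι ℂ (dzbar x k))

/-- The positive volume form `i dz_1 ∧ dz̄_1 ∧ … ∧ i dz_n ∧ dz̄_n`. -/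
def coordVol (x : X) : FormsAt (n := n) x :=
  (List.ofFn fun j : Fin n =>
    Complex.I • (ExteriorAlgebra.ι ℂ (dz x j) * ExteriorAlgebra.ι ℂ (dzbar x j))).prod

/-- The order on `(n,n)`-forms at a point: `u ≤ v` when `v - u` is a nonnegative multiple of the
positive volume form. -/
def VolLE (x : X) (u v : FormsAt (n := n) x) : Prop :=
  ∃ t : ℝ, 0 ≤ t ∧ v = u + (t : ℂ) • coordVol x

end Forms

/-! ### Hermitian holomorphic vector bundles

`E` is a holomorphic vector bundle of rank `r` over the complex manifold `X` of dimension `n`, and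
the hermitian metric `h` is given by the inner products of the fibres.  Mathlib's `inner ℂ v w` is
linear in `w`, so that `⟨v, w⟩_h` (linear in `v`) is `inner ℂ w v`. -/

section Bundles

variable {n r : ℕ} {X : Type*} [TopologicalSpace X] [ChartedSpace (Cn n) X]
  (E : X → Type*) [TopologicalSpace (TotalSpace (Cn r) E)]
  [∀ x, NormedAddCommGroup (E x)] [∀ x, InnerProductSpace ℂ (E x)]
  [FiberBundle (Cn r) E] [VectorBundle ℂ (Cn r) E]

/-- The Gram matrix `H_{λμ} = ⟨e_λ, e_μ⟩_h` of the holomorphic frame `(e_λ)` of the local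
trivialization of `E` at `x`, as a function on the chart of `X` at `x`. -/
def gram (x : X) (z : Cn n) : Matrix (Fin r) (Fin r) ℂ :=
  let e := (trivializationAt (Cn r) E x).localFrame (EuclideanSpace.basisFun (Fin r) ℂ).toBasis
  let p : X := (chartAt (Cn n) x).symm z
  Matrix.of fun l m => inner ℂ (e m p) (e l p)

variable (n r) in
/-- The hermitian metric is smooth (`C^∞` in the real sense): so are the coefficients of its Gram
matrices in the local holomorphic frames and coordinates. -/
def IsSmoothMetric : Prop :=
  ∀ (x : X) (l m : Fin r),
    ContDiffOn ℝ ∞ (fun z : Cn n => gram (r := r) E x z l m)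
      ((chartAt (Cn n) x).target ∩
        (chartAt (Cn n) x).symm ⁻¹' (trivializationAt (Cn r) E x).baseSet)

variable (r) in
/-- The basis of `E_x` given by the holomorphic frame of the local trivialization at `x`. -/
def fiberBasis (x : X) : Module.Basis (Fin r) ℂ (E x) :=
  (trivializationAt (Cn r) E x).basisAt (EuclideanSpace.basisFun (Fin r) ℂ).toBasis
    (mem_baseSet_trivializationAt (Cn r) E x)

variable (r) in
/-- An `h`-orthonormal frame of `E_x` (the notions below do not depend on its choice). -/
def orthoFrame (x : X) : OrthonormalBasis (Fin r) ℂ (E x) :=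
  haveI : FiniteDimensional ℂ (E x) := (fiberBasis r E x).finiteDimensional_of_finite
  (stdOrthonormalBasis ℂ (E x)).reindex
    (finCongr ((Module.finrank_eq_card_basis (fiberBasis r E x)).trans (Fintype.card_fin r)))

variable (r) in
/-- The coefficients of the Chern curvature tensor
`Θ_{E,h} = i ∇² = i ∑_{j,k} dz_j ∧ dz̄_k ⊗ curvEnd x j k` at `x`, as endomorphisms of `E_x`. -/
def curvEnd (x : X) (j k : Fin n) : E x →ₗ[ℂ] E x :=
  Matrix.toLin (fiberBasis r E x) (fiberBasis r E x)
    (chernCurvature (gram (r := r) E x) j k (chartAt (Cn n) x x)).transpose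

/-- The coefficients `c_{jkλμ}` of the curvature in the orthonormal frame `(u_λ)`:
`Θ_{E,h} = i ∑ c_{jkλμ} dz_j ∧ dz̄_k ⊗ u_λ^* ⊗ u_μ`. -/
def curvCoeff (x : X) (j k : Fin n) (l m : Fin r) : ℂ :=
  inner ℂ (orthoFrame r E x m) (curvEnd r E x j k (orthoFrame r E x l))

variable (r) in
/-- The coefficients of the `(1,1)`-form `⟨Θ_{E,h} ⬝ v, v⟩_h`, for `v ∈ E_x`. -/
def curvOn (x : X) (v : E x) (j k : Fin n) : ℂ :=
  inner ℂ v (curvEnd r E x j k v)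

variable (n r) in
/-- Griffiths positivity: `∑ ⟨Θ_{jk} v, v⟩ ξ_j ξ̄_k > 0` for all nonzero `ξ ∈ T_x X`, `v ∈ E_x`. -/
def GriffithsPositive : Prop :=
  ∀ (x : X) (ξ : Fin n → ℂ) (v : E x), ξ ≠ 0 → v ≠ 0 →
    0 < (∑ j, ∑ k, curvOn r E x v j k * ξ j * star (ξ k)).re

variable (n r) in
/-- Nakano positivity: `∑ c_{jkλμ} γ_{jλ} γ̄_{kμ} > 0` for all nonzero
`γ = ∑ γ_{jλ} ∂/∂z_j ⊗ u_λ` in `T_x X ⊗ E_x`. -/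
def NakanoPositive : Prop :=
  ∀ (x : X) (γ : Fin n → Fin r → ℂ), γ ≠ 0 →
    0 < (∑ j, ∑ k, ∑ l, ∑ m, curvCoeff E x j k l m * γ j l * star (γ k m)).re

variable (n r) in
/-- Dual Nakano positivity: `∑ c_{jkμλ} γ_{jλ} γ̄_{kμ} > 0` for all nonzero
`γ = ∑ γ_{jλ} ∂/∂z_j ⊗ u_λ^*` in `T_x X ⊗ E_x^*`. -/
def DualNakanoPositive : Prop :=
  ∀ (x : X) (γ : Fin n → Fin r → ℂ), γ ≠ 0 →
    0 < (∑ j, ∑ k, ∑ l, ∑ m, curvCoeff E x j k m l * γ j l * star (γ k m)).re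

variable (n r) in
/-- The `(nr) × (nr)` determinant of `(c_{jkλμ})_{(j,λ),(k,μ)}`, to the power `1/r`, as an
`(n,n)`-form. -/
def PhiN (x : X) : FormsAt (n := n) x :=
  (((Matrix.of fun a b : Fin n × Fin r => curvCoeff E x a.1 b.1 a.2 b.2).det.re
    ^ (1 / (r : ℝ)) : ℝ) : ℂ) • coordVol x

variable (n r) in
/-- The `(nr) × (nr)` determinant of `(c_{jkμλ})_{(j,λ),(k,μ)}`, to the power `1/r`, as an
`(n,n)`-form. -/
def PhiNdual (x : X) : FormsAt (n := n) x :=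
  (((Matrix.of fun a b : Fin n × Fin r => curvCoeff E x a.1 b.1 b.2 a.2).det.re
    ^ (1 / (r : ℝ)) : ℝ) : ℂ) • coordVol x

variable (n r) in
/-- The infimum of the `(n,n)`-forms `(1/n!) ⟨Θ_{E,h} ⬝ v, v⟩_h^n` over the unit vectors `v` of
`E_x`; the infimum of multiples of the positive volume form is that of their densities. -/
def PhiG (x : X) : FormsAt (n := n) x :=
  ((sInf {t : ℝ | ∃ v : E x, ‖v‖ = 1 ∧
    (1 / (n.factorial : ℂ)) • form11 (n := n) x (curvOn r E x v) ^ n = (t : ℂ) • coordVol x} : ℝ) : ℂ)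
      • coordVol x

variable (r) in
/-- The coefficients of the curvature form of `(det E, det h)` at `x`.  In the holomorphic frame
`e_1 ∧ … ∧ e_r` of the line bundle `det E = Λ^r E`, the metric `det h` is given by
`|e_1 ∧ … ∧ e_r|² = det (⟨e_λ, e_μ⟩_h)`. -/
def detCurvCoeff (x : X) (j k : Fin n) : ℂ :=
  chernCurvature (m := 1) (fun z => Matrix.of fun _ _ => (gram (r := r) E x z).det) j k
    (chartAt (Cn n) x x) 0 0

variable (r) in
/-- The `(1,1)`-form `Θ_{det E, det h}` at `x`. -/
def detCurv (x : X) : FormsAt (n := n) x := form11 x (detCurvCoeff r E x)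

variable (n r) in
/-- The `(n,n)`-form `(Θ_{det E, det h})^n / (n! r^n)` at `x`. -/
def detVolume (x : X) : FormsAt (n := n) x :=
  (1 / ((n.factorial : ℂ) * (r : ℂ) ^ n)) • detCurv r E x ^ n

variable (n r) in
/-- `Θ_{det E, det h} > 0`, as a `(1,1)`-form. -/
def DetPositive : Prop :=
  ∀ (x : X) (ξ : Fin n → ℂ), ξ ≠ 0 →
    0 < (∑ j, ∑ k, detCurvCoeff r E x j k * ξ j * star (ξ k)).re

variable (n r) in
/-- `(E,h)` is projectively flat: `Θ_{E,h} = α ⊗ Id_E` for some `(1,1)`-form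
`α = i ∑ a_{jk} dz_j ∧ dz̄_k` on `X`. (Taking traces, `α` is `1/r` times the trace of the
curvature, so that it is automatically real and smooth.) -/
def ProjectivelyFlat : Prop :=
  ∃ a : X → Fin n → Fin n → ℂ, ∀ (x : X) (j k : Fin n),
    curvEnd r E x j k = a x j k • LinearMap.id

end Bundles

end ChernForms

end

open ChernForms

/-! The statement is pointwise linear algebra. In coordinates at `x` and an orthonormal frame, the
curvature is a hermitian matrix `C` on `T ⊗ E` (or on `T ⊗ E^*`), and its partial trace `T` over the
fibre is the matrix of the curvature of `det E`.

The engine is the arithmetic-geometric mean inequality for positive definite `P`, `S` of size `N`: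
if `tr(S⁻¹P) ≤ N`, then `det P ≤ det S`, with equality only for `P = S`
(`re_det_le_of_trace_inv_mul_le`, `eq_of_trace_inv_mul_le`). In the Nakano and dual Nakano cases
take `P = C` and `S = (T/r) ⊗ 1`: the trace is exactly `nr` and `det S = det(T/r)^r`, so an `r`-th
root gives the bound, and equality means `C = (T/r) ⊗ 1`, that is, scalar curvature.

In the Griffiths case the matrices of `⟨Θ u_l, u_l⟩` over an orthonormal basis have mean `S = T/r`.
The traces `tr(S⁻¹C_l)` average to `n`, so one of the determinants is at most `det S`. If the
infimum equals `det S`, every `C_l` equals `S`; as every unit vector lies in some orthonormal basis,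
the form `⟨Θv, v⟩` is `T/r` on the unit sphere, and polarization makes `Θ` scalar.

Two bridges lead back to geometry: `form11_pow` with `coordVol_ne_zero` turns `(n,n)`-forms into
determinants, and `conjTranspose_chernCurvature_mul` with `chernCurvature_det` supplies hermitian
symmetry and the trace identity. -/

section MatrixInequality

open Matrix
open scoped ComplexOrder Kronecker

variable {ι κ : Type*} [Fintype ι] [DecidableEq ι] [Fintype κ] [DecidableEq κ]

/-! ### Arithmetic-geometric mean inequality for positive definite matrices. -/

namespace Matrix.PosDef

lemma re_det_eq_prod {A : Matrix ι ι ℂ} (hA : A.PosDef) :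
    A.det.re = ∏ i, hA.1.eigenvalues i := by
  rw [hA.1.det_eq_prod_eigenvalues]
  have : (∏ i, ((hA.1.eigenvalues i : ℝ) : ℂ)) = ((∏ i, hA.1.eigenvalues i : ℝ) : ℂ) := by
    push_cast; rfl
  exact congrArg Complex.re this

lemma re_trace_eq_sum {A : Matrix ι ι ℂ} (hA : A.PosDef) :
    A.trace.re = ∑ i, hA.1.eigenvalues i := by
  rw [hA.1.trace_eq_sum_eigenvalues]
  simp

lemma re_det_pos {A : Matrix ι ι ℂ} (hA : A.PosDef) : 0 < A.det.re :=
  (Complex.lt_def.1 hA.det_pos).1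

lemma det_eq_re {A : Matrix ι ι ℂ} (hA : A.PosDef) : A.det = (A.det.re : ℂ) :=
  Complex.ext rfl (by simpa using (Complex.lt_def.1 hA.det_pos).2.symm)

/-- Each eigenvalue satisfies `λ ≤ exp(λ - 1)`; multiplying, the determinant is at most `exp(tr A -
card ι)`. -/
lemma re_det_le_one {A : Matrix ι ι ℂ} (hA : A.PosDef)
    (h : A.trace.re ≤ Fintype.card ι) : A.det.re ≤ 1 := by
  rw [hA.re_det_eq_prod]
  rw [hA.re_trace_eq_sum] at h
  calc ∏ i, hA.1.eigenvalues i ≤ ∏ i, Real.exp (hA.1.eigenvalues i - 1) :=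
        Finset.prod_le_prod (fun i _ => (hA.eigenvalues_pos i).le) fun i _ => by
          simpa using Real.add_one_le_exp (hA.1.eigenvalues i - 1)
    _ = Real.exp (∑ i, hA.1.eigenvalues i - Fintype.card ι) := by
        rw [← Real.exp_sum]; simp
    _ ≤ 1 := Real.exp_le_one_iff.2 (by linarith)

/-- The bound `λ ≤ exp(λ - 1)` is strict unless `λ = 1`, so a single eigenvalue different from `1`
would push the determinant below `1`. -/
lemma eq_one_of_one_le_re_det {A : Matrix ι ι ℂ} (hA : A.PosDef)
    (h : A.trace.re ≤ Fintype.card ι) (hd : 1 ≤ A.det.re) : A = 1 := by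
  have key : ∀ i, hA.1.eigenvalues i = 1 := by
    by_contra! hne
    obtain ⟨i, hi⟩ := hne
    rw [hA.re_det_eq_prod] at hd
    rw [hA.re_trace_eq_sum] at h
    have : ∏ i, hA.1.eigenvalues i < ∏ i, Real.exp (hA.1.eigenvalues i - 1) :=
        Finset.prod_lt_prod (fun i _ => hA.eigenvalues_pos i)
          (fun i _ => by simpa using Real.add_one_le_exp (hA.1.eigenvalues i - 1))
          ⟨i, Finset.mem_univ _, by
            simpa using Real.add_one_lt_exp (x := hA.1.eigenvalues i - 1) (sub_ne_zero.2 hi)⟩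
    have h2 : ∏ i, Real.exp (hA.1.eigenvalues i - 1)
        = Real.exp (∑ i, hA.1.eigenvalues i - Fintype.card ι) := by
      rw [← Real.exp_sum]; simp
    have h3 : Real.exp (∑ i, hA.1.eigenvalues i - Fintype.card ι) ≤ 1 :=
      Real.exp_le_one_iff.2 (by linarith)
    linarith
  rw [hA.1.spectral_theorem]
  have : (diagonal (RCLike.ofReal ∘ hA.1.eigenvalues) : Matrix ι ι ℂ) = 1 := by
    rw [← diagonal_one]
    congr 1
    funext i
    simp [key i]
  rw [this, map_one]

lemma exists_isUnit_conjTranspose_mul {S : Matrix ι ι ℂ} (hS : S.PosDef) :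
    ∃ B : Matrix ι ι ℂ, IsUnit B ∧ S = Bᴴ * B := by
  open scoped MatrixOrder in
  have h0 : 0 ≤ S := nonneg_iff_posSemidef.2 hS.posSemidef
  obtain ⟨B, hB⟩ := CStarAlgebra.nonneg_iff_eq_star_mul_self.mp h0
  refine ⟨B, ?_, hB⟩
  have := hS.isUnit
  rw [hB] at this
  rw [isUnit_iff_isUnit_det] at this ⊢
  rw [det_mul] at this
  exact isUnit_of_mul_isUnit_right this

/-- Reduction of the pair `(P, S)` to the case `S = 1`: writing `S = Bᴴ B`, conjugation by `B⁻¹`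
sends `S` to `1` and turns `tr(S⁻¹P)` and `det P / det S` into an ordinary trace and determinant. -/
lemma conj_inv_data {P S : Matrix ι ι ℂ} (hP : P.PosDef) (hS : S.PosDef) :
    ∃ B : Matrix ι ι ℂ, IsUnit B ∧ S = Bᴴ * B ∧ ((B⁻¹)ᴴ * P * B⁻¹).PosDef ∧
      ((B⁻¹)ᴴ * P * B⁻¹).trace = (S⁻¹ * P).trace ∧
      P.det.re = ((B⁻¹)ᴴ * P * B⁻¹).det.re * S.det.re := by
  obtain ⟨B, hB, rfl⟩ := hS.exists_isUnit_conjTranspose_mul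
  have hP' : ((B⁻¹)ᴴ * P * B⁻¹).PosDef := by
    have hu : IsUnit B⁻¹ := by
      rwa [isUnit_nonsing_inv_iff]
    exact (hu.posDef_star_left_conjugate_iff).2 hP
  refine ⟨B, hB, rfl, hP', ?_, ?_⟩
  · rw [mul_inv_rev, Matrix.trace_mul_cycle, conjTranspose_nonsing_inv, mul_assoc]
  · have h1 : (B⁻¹).det * B.det = 1 := by
      rw [← det_mul, nonsing_inv_mul _ ((isUnit_iff_isUnit_det _).1 hB), det_one]
    have : P.det = ((B⁻¹)ᴴ * P * B⁻¹).det * (Bᴴ * B).det := by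
      have h2 : star (B⁻¹).det * star B.det = 1 := by rw [← star_mul', h1, star_one]
      simp only [det_mul, det_conjTranspose]
      linear_combination (-P.det) * h1 - P.det * (B⁻¹).det * B.det * h2
    rw [this, hP'.det_eq_re, hS.det_eq_re, ← Complex.ofReal_mul]
    simp

/-- A multiplicative form of the inequality between arithmetic and geometric means. -/
theorem re_det_le_of_trace_inv_mul_le {P S : Matrix ι ι ℂ} (hP : P.PosDef) (hS : S.PosDef)
    (h : (S⁻¹ * P).trace.re ≤ Fintype.card ι) : P.det.re ≤ S.det.re := by
  obtain ⟨B, -, -, hP', htr, hdet⟩ := hP.conj_inv_data hS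
  rw [hdet]
  have := hP'.re_det_le_one (by rwa [htr])
  nlinarith [hS.re_det_pos]

theorem eq_of_trace_inv_mul_le {P S : Matrix ι ι ℂ} (hP : P.PosDef) (hS : S.PosDef)
    (h : (S⁻¹ * P).trace.re ≤ Fintype.card ι) (hd : S.det.re ≤ P.det.re) : P = S := by
  obtain ⟨B, hB, hSB, hP', htr, hdet⟩ := hP.conj_inv_data hS
  have h1 : (B⁻¹)ᴴ * P * B⁻¹ = 1 := by
    refine hP'.eq_one_of_one_le_re_det (by rwa [htr]) ?_
    rw [hdet] at hd
    exact le_of_mul_le_mul_right (by linarith) hS.re_det_pos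
  have hBd := (isUnit_iff_isUnit_det _).1 hB
  have h2 : Bᴴ * (B⁻¹)ᴴ = 1 := by
    rw [← conjTranspose_mul, nonsing_inv_mul _ hBd, conjTranspose_one]
  calc P = (Bᴴ * (B⁻¹)ᴴ) * P * (B⁻¹ * B) := by
        rw [h2, nonsing_inv_mul _ hBd, one_mul, mul_one]
    _ = Bᴴ * ((B⁻¹)ᴴ * P * B⁻¹) * B := by simp only [mul_assoc]
    _ = S := by rw [h1, mul_one, hSB]

end Matrix.PosDef

/-! ### Partial traces and means of positive definite matrices. -/

namespace Matrix

/-- The partial trace over the second index. -/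
def partialTrace (C : Matrix (ι × κ) (ι × κ) ℂ) : Matrix ι ι ℂ :=
  of fun j k => ∑ l, C (j, l) (k, l)

omit [Fintype ι] [DecidableEq ι] [DecidableEq κ] in
lemma partialTrace_eq_sum_submatrix (C : Matrix (ι × κ) (ι × κ) ℂ) :
    partialTrace C = ∑ l, C.submatrix (fun j => (j, l)) (fun j => (j, l)) := by
  ext j k
  simp [partialTrace, Matrix.sum_apply]

omit [DecidableEq ι] in
-- The partial trace is adjoint to `A ↦ A ⊗ 1` for the trace pairing.
lemma trace_kronecker_one_mul (A : Matrix ι ι ℂ) (C : Matrix (ι × κ) (ι × κ) ℂ) :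
    ((A ⊗ₖ (1 : Matrix κ κ ℂ)) * C).trace = (A * partialTrace C).trace := by
  simp only [trace, diag_apply, mul_apply, Fintype.sum_prod_type, kroneckerMap_apply,
    partialTrace, of_apply, one_apply, mul_ite, mul_one, mul_zero, ite_mul, zero_mul,
    Finset.sum_ite_eq, Finset.mem_univ, if_true, Finset.mul_sum]
  exact Finset.sum_congr rfl fun i _ => Finset.sum_comm

omit [Fintype ι] [DecidableEq ι] [DecidableEq κ] in
lemma PosDef.partialTrace [Nonempty κ] {C : Matrix (ι × κ) (ι × κ) ℂ} (hC : C.PosDef) :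
    (partialTrace C).PosDef := by
  rw [partialTrace_eq_sum_submatrix]
  refine posDef_sum Finset.univ_nonempty fun l _ => hC.submatrix ?_
  intro a b h
  simpa using h

omit [Fintype ι] [DecidableEq ι] in
lemma PosDef.inv_smul_nat {S : Matrix ι ι ℂ} (hS : S.PosDef) {r : ℕ} (hr : 0 < r) :
    ((r : ℂ)⁻¹ • S).PosDef :=
  hS.smul (inv_pos.2 (by exact_mod_cast hr))

lemma inv_inv_smul_nat_mul {S T : Matrix ι ι ℂ} {r : ℕ} (hr : 0 < r) (hS : IsUnit S.det) :
    ((r : ℂ)⁻¹ • S)⁻¹ * T = (r : ℂ) • (S⁻¹ * T) := by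
  have h0 : (r : ℂ) ≠ 0 := by exact_mod_cast hr.ne'
  have : ((r : ℂ)⁻¹ • S)⁻¹ = (r : ℂ) • S⁻¹ := by
    apply inv_eq_left_inv
    rw [smul_mul_smul_comm, mul_inv_cancel₀ h0, nonsing_inv_mul _ hS, one_smul]
  rw [this, smul_mul_assoc]

/-- By adjointness the trace is `card κ * tr(T⁻¹T)` with `T` the partial trace, which is exactly the
threshold in the determinant inequality. -/
lemma PosDef.trace_kronecker_inv_mul [Nonempty κ] {C : Matrix (ι × κ) (ι × κ) ℂ}
    (hC : C.PosDef) :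
    ((((Fintype.card κ : ℂ)⁻¹ • Matrix.partialTrace C) ⊗ₖ (1 : Matrix κ κ ℂ))⁻¹ * C).trace.re
      = Fintype.card (ι × κ) := by
  have hT := hC.partialTrace
  have hu : IsUnit (Matrix.partialTrace C).det := (isUnit_iff_isUnit_det _).1 hT.isUnit
  rw [inv_kronecker, inv_one, trace_kronecker_one_mul,
    inv_inv_smul_nat_mul Fintype.card_pos hu, nonsing_inv_mul _ hu, trace_smul, trace_one]
  simp [mul_comm]

lemma PosDef.re_det_kronecker_one {S : Matrix ι ι ℂ} (hS : S.PosDef) :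
    (S ⊗ₖ (1 : Matrix κ κ ℂ)).det.re = S.det.re ^ Fintype.card κ := by
  rw [det_kronecker, det_one, one_pow, mul_one, hS.det_eq_re, ← Complex.ofReal_pow]
  exact Complex.ofReal_re _

theorem PosDef.re_det_le_partialTrace [Nonempty κ] {C : Matrix (ι × κ) (ι × κ) ℂ}
    (hC : C.PosDef) :
    C.det.re ≤ ((Fintype.card κ : ℂ)⁻¹ • Matrix.partialTrace C).det.re ^ Fintype.card κ := by
  have hS := hC.partialTrace.inv_smul_nat (r := Fintype.card κ) Fintype.card_pos
  exact (hC.re_det_le_of_trace_inv_mul_le (hS.kronecker PosDef.one)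
    hC.trace_kronecker_inv_mul.le).trans_eq hS.re_det_kronecker_one

theorem PosDef.eq_kronecker_of_le_re_det [Nonempty κ] {C : Matrix (ι × κ) (ι × κ) ℂ}
    (hC : C.PosDef)
    (h : ((Fintype.card κ : ℂ)⁻¹ • Matrix.partialTrace C).det.re ^ Fintype.card κ ≤ C.det.re) :
    C = ((Fintype.card κ : ℂ)⁻¹ • Matrix.partialTrace C) ⊗ₖ (1 : Matrix κ κ ℂ) := by
  have hS := hC.partialTrace.inv_smul_nat (r := Fintype.card κ) Fintype.card_pos
  exact hC.eq_of_trace_inv_mul_le (hS.kronecker PosDef.one)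
    hC.trace_kronecker_inv_mul.le (hS.re_det_kronecker_one.le.trans h)

omit [DecidableEq κ] in
/-- The mean of the traces of `S⁻¹ * C l` when `S` is the mean of the `C l`. -/
lemma sum_trace_inv_mul [Nonempty κ] {C : κ → Matrix ι ι ℂ}
    (hC : (∑ l, C l).PosDef) :
    ∑ l, ((((Fintype.card κ : ℂ)⁻¹ • ∑ l, C l)⁻¹ * C l).trace.re)
      = ∑ _l : κ, (Fintype.card ι : ℝ) := by
  have hu : IsUnit (∑ l, C l).det := (isUnit_iff_isUnit_det _).1 hC.isUnit
  rw [← Complex.re_sum, ← trace_sum, ← Finset.mul_sum,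
    inv_inv_smul_nat_mul Fintype.card_pos hu, nonsing_inv_mul _ hu, trace_smul, trace_one]
  simp

omit [DecidableEq κ] in
-- Some `l` has `tr(S⁻¹C_l)` at most the average `card ι`, and the determinant inequality applies to
-- it.
theorem exists_re_det_le_mean [Nonempty κ] {C : κ → Matrix ι ι ℂ} (hC : ∀ l, (C l).PosDef) :
    ∃ l, (C l).det.re ≤ ((Fintype.card κ : ℂ)⁻¹ • ∑ l, C l).det.re := by
  have hT : (∑ l, C l).PosDef := posDef_sum Finset.univ_nonempty fun l _ => hC l
  have hS := hT.inv_smul_nat (r := Fintype.card κ) Fintype.card_pos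
  obtain ⟨l, -, hl⟩ := Finset.exists_le_of_sum_le Finset.univ_nonempty (sum_trace_inv_mul hT).le
  exact ⟨l, (hC l).re_det_le_of_trace_inv_mul_le hS hl⟩

omit [DecidableEq κ] in
theorem eq_mean_of_le_re_det [Nonempty κ] {C : κ → Matrix ι ι ℂ} (hC : ∀ l, (C l).PosDef)
    (h : ∀ l, ((Fintype.card κ : ℂ)⁻¹ • ∑ l, C l).det.re ≤ (C l).det.re) (l : κ) :
    C l = (Fintype.card κ : ℂ)⁻¹ • ∑ l, C l := by
  have hT : (∑ l, C l).PosDef := posDef_sum Finset.univ_nonempty fun l _ => hC l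
  have hS := hT.inv_smul_nat (r := Fintype.card κ) Fintype.card_pos
  have hge : ∀ l, (Fintype.card ι : ℝ) ≤
      (((Fintype.card κ : ℂ)⁻¹ • ∑ l, C l)⁻¹ * C l).trace.re := by
    intro l
    -- A trace below the threshold would, by the equality case, force `C l = S`, whose trace is the
    -- threshold itself. So all traces reach the threshold, and since they average to it, all are
    -- equal to it.
    by_contra! hlt
    have heq := (hC l).eq_of_trace_inv_mul_le hS hlt.le (h l)
    rw [← heq, nonsing_inv_mul _ ((isUnit_iff_isUnit_det _).1 (hC l).isUnit), trace_one] at hlt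
    simp at hlt
  have := (Finset.sum_eq_sum_iff_of_le fun l (_ : l ∈ Finset.univ) => hge l).1
    (sum_trace_inv_mul hT).symm l (Finset.mem_univ l)
  exact (hC l).eq_of_trace_inv_mul_le hS this.ge (h l)

end Matrix

end MatrixInequality

/-! ### Powers of sums of commuting square-zero elements. -/

section NilpotentPowers

variable {R : Type*} [Ring R]

lemma Commute.add_pow_succ_of_mul_self_eq_zero {a s : R} (h : Commute a s) (ha : a * a = 0)
    (m : ℕ) : (a + s) ^ (m + 1) = s ^ (m + 1) + (m + 1) • (a * s ^ m) := by
  induction m with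
  | zero => simp [add_comm]
  | succ m ih =>
    rw [pow_succ', ih, add_mul, mul_add, mul_add, mul_smul_comm, ← mul_assoc, ha, zero_mul,
      smul_zero, add_zero, ← pow_succ', mul_smul_comm, ← mul_assoc, ← h.eq, mul_assoc,
      ← pow_succ', succ_nsmul _ (m + 1)]
    abel

/-- Only the square-free monomial survives in the expansion, once for each ordering of its factors.
The vanishing of the next power is proved alongside because the induction uses it for the tail of
the sum. -/
lemma sum_pow_of_commute_of_mul_self_eq_zero :
    ∀ {n : ℕ} (w : Fin n → R), (∀ i j, Commute (w i) (w j)) → (∀ i, w i * w i = 0) →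
      (∑ i, w i) ^ n = n.factorial • (List.ofFn w).prod ∧ (∑ i, w i) ^ (n + 1) = 0
  | 0, w, _, _ => by simp
  | n + 1, w, hc, h0 => by
    obtain ⟨h1, h2⟩ := sum_pow_of_commute_of_mul_self_eq_zero (fun i => w i.succ)
      (fun i j => hc _ _) (fun i => h0 _)
    have hcomm : Commute (w 0) (∑ i : Fin n, w i.succ) :=
      Commute.sum_right _ _ _ fun i _ => hc _ _
    rw [Fin.sum_univ_succ, hcomm.add_pow_succ_of_mul_self_eq_zero (h0 0),
      hcomm.add_pow_succ_of_mul_self_eq_zero (h0 0), h2, h1, pow_succ _ (n + 1), h2]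
    refine ⟨?_, by simp⟩
    rw [zero_add, List.ofFn_succ, List.prod_cons, mul_smul_comm, smul_smul,
      Nat.factorial_succ]

end NilpotentPowers

/-! ### Determinants and nonvanishing of products in the exterior algebra. -/

namespace ExteriorAlgebra

variable {K M : Type*} [Field K] [AddCommGroup M] [Module K M]

lemma ι_mul_swap (x y : M) : ι K x * ι K y = -(ι K y * ι K x) :=
  eq_neg_of_add_eq_zero_left (ι_add_mul_swap x y)

lemma commute_ι_mul_ι_ι (x y u : M) : Commute (ι K x * ι K y) (ι K u) := by
  unfold Commute SemiconjBy
  rw [mul_assoc, ι_mul_swap y u, mul_neg, ← mul_assoc, ι_mul_swap x u, neg_mul, neg_neg, mul_assoc]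

lemma commute_ι_mul_ι (x y u v : M) : Commute (ι K x * ι K y) (ι K u * ι K v) :=
  (commute_ι_mul_ι_ι x y u).mul_right (commute_ι_mul_ι_ι x y v)

lemma ι_mul_ι_mul_self (x y : M) : ι K x * ι K y * (ι K x * ι K y) = 0 := by
  rw [← mul_assoc, (commute_ι_mul_ι_ι x y x).eq, ← mul_assoc, ι_sq_zero, zero_mul, zero_mul]

lemma ι_mul_prod_ι (y : M) :
    ∀ {n : ℕ} (z : Fin n → M), ι K y * (List.ofFn fun i => ι K (z i)).prod
      = (-1 : K) ^ n • ((List.ofFn fun i => ι K (z i)).prod * ι K y)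
  | 0, z => by simp
  | n + 1, z => by
    rw [List.ofFn_succ, List.prod_cons, ← mul_assoc, ι_mul_swap, neg_mul, mul_assoc, ι_mul_prod_ι,
      pow_succ, mul_smul_comm, mul_assoc]
    simp

/-- A product of two-forms can be sorted, up to a universal sign. -/
lemma exists_prod_ι_mul_ι (n : ℕ) : ∃ c : K, ∀ z y : Fin n → M,
    (List.ofFn fun i => ι K (z i) * ι K (y i)).prod
      = c • ((List.ofFn fun i => ι K (z i)).prod * (List.ofFn fun i => ι K (y i)).prod) := by
  induction n with
  | zero => exact ⟨1, by simp⟩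
  | succ n ih =>
    obtain ⟨c, hc⟩ := ih
    refine ⟨c * (-1) ^ n, fun z y => ?_⟩
    simp only [List.ofFn_succ, List.prod_cons]
    rw [hc, mul_smul_comm, mul_smul]
    congr 1
    rw [mul_assoc (ι K (z 0)), ← mul_assoc (ι K (y 0)), ι_mul_prod_ι]
    simp only [smul_mul_assoc, mul_smul_comm, mul_assoc]

/-- Both sides are alternating in the rows of `a`, so it suffices to compare them on distinct
standard basis vectors, that is, on permutations, where each gives the sign. -/
lemma ιMulti_sum_smul {n : ℕ} (a : Matrix (Fin n) (Fin n) K) (y : Fin n → M) :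
    ιMulti K n (fun i => ∑ k, a i k • y k) = a.det • ιMulti K n y := by
  let f : (Fin n → K) →ₗ[K] M := Fintype.linearCombination K y
  have key : (ιMulti K n).compLinearMap f
      = ((LinearMap.toSpanSingleton K (ExteriorAlgebra K M) (ιMulti K n y)).compAlternatingMap
          (Matrix.detRowAlternating (R := K) (n := Fin n))) := by
    refine Module.Basis.ext_alternating (Pi.basisFun K (Fin n)) fun v hv => ?_
    obtain ⟨σ, rfl⟩ : ∃ σ : Equiv.Perm (Fin n), (σ : Fin n → Fin n) = v :=
      ⟨Equiv.ofBijective v (Finite.injective_iff_bijective.1 hv), rfl⟩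
    simp only [AlternatingMap.compLinearMap_apply, LinearMap.compAlternatingMap_apply,
      LinearMap.toSpanSingleton_apply]
    have h1 : (fun i => f ((Pi.basisFun K (Fin n)) (σ i))) = fun i => y (σ i) := by
      funext i
      simp [f, Fintype.linearCombination_apply, Pi.single_apply]
    have h2 : Matrix.detRowAlternating (fun i => (Pi.basisFun K (Fin n)) (σ i))
        = ((Equiv.Perm.sign σ : ℤ) : K) := by
      have := (Matrix.detRowAlternating (R := K) (n := Fin n)).map_perm
        (fun i => (Pi.basisFun K (Fin n)) i) σ
      simp only [Function.comp_def] at this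
      rw [this]
      have h3 : Matrix.detRowAlternating (fun i => (Pi.basisFun K (Fin n)) i) = (1 : K) := by
        rw [← Matrix.det_one (n := Fin n) (R := K)]
        congr 1
        ext i j
        simp [Matrix.one_apply, Pi.single_apply, eq_comm]
      rw [h3, Units.smul_def, zsmul_one]
    rw [h2]
    have h4 := (ιMulti K n).map_perm y σ
    simp only [Function.comp_def] at h4
    rw [h1, h4, Units.smul_def, Int.cast_smul_eq_zsmul]
  have : ιMulti K n (fun i => f (a i)) = a.det • ιMulti K n y := DFunLike.congr_fun key a
  simpa [f, Fintype.linearCombination_apply] using this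

/-- Gathering the second factors exposes an `n`-fold wedge from which the determinant comes out. The
sorting constant is the same on both sides, so its value is irrelevant. -/
lemma prod_ι_mul_ι_sum_smul {n : ℕ} (a : Matrix (Fin n) (Fin n) K) (z y : Fin n → M) :
    (List.ofFn fun i => ι K (z i) * ι K (∑ k, a i k • y k)).prod
      = a.det • (List.ofFn fun i => ι K (z i) * ι K (y i)).prod := by
  obtain ⟨c, hc⟩ := exists_prod_ι_mul_ι (K := K) (M := M) n
  rw [hc z y, hc z fun i => ∑ k, a i k • y k]
  simp only [← ιMulti_apply]
  rw [ιMulti_sum_smul, mul_smul_comm, smul_comm]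

open CliffordAlgebra in
lemma contractLeft_prod_eq_zero {J : Type*} (d : Module.Dual K M) (z y : J → M) :
    ∀ L : List J, (∀ j ∈ L, d (z j) = 0 ∧ d (y j) = 0) →
      contractLeft (Q := (0 : QuadraticForm K M)) d
        ((L.map fun j => ExteriorAlgebra.ι K (z j) * ExteriorAlgebra.ι K (y j)).prod) = 0
  | [], _ => by
    rw [List.map_nil, List.prod_nil]; exact contractLeft_one (Q := (0 : QuadraticForm K M)) d
  | j :: L, h => by
    rw [List.map_cons, List.prod_cons, mul_assoc]
    erw [contractLeft_ι_mul, contractLeft_ι_mul]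
    rw [contractLeft_prod_eq_zero d z y L fun k hk => h k (List.mem_cons_of_mem _ hk)]
    simp [h j List.mem_cons_self]

open CliffordAlgebra in
-- Contracting with `d j` and then `e j` strips off the leading factor and kills nothing else, so a
-- vanishing product would lead down to `1 = 0`.
lemma prod_ι_mul_ι_ne_zero {J : Type*} [DecidableEq J] (z y : J → M) (d e : J → Module.Dual K M)
    (hdz : ∀ i j, d i (z j) = if i = j then 1 else 0) (hdy : ∀ i j, d i (y j) = 0)
    (hez : ∀ i j, e i (z j) = 0) (hey : ∀ i j, e i (y j) = if i = j then 1 else 0) :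
    ∀ L : List J, L.Nodup → (L.map fun j => ι K (z j) * ι K (y j)).prod ≠ 0
  | [], _ => by simp
  | j :: L, hL => by
    obtain ⟨hj, hL⟩ := List.nodup_cons.1 hL
    intro h0
    have hd := contractLeft_prod_eq_zero (d j) z y L fun k hk => by
      have : j ≠ k := fun h => hj (h ▸ hk)
      simp [hdz, hdy, this]
    have he := contractLeft_prod_eq_zero (e j) z y L fun k hk => by
      have : j ≠ k := fun h => hj (h ▸ hk)
      simp [hez, hey, this]
    have h1 := congrArg (fun t => contractLeft (Q := (0 : QuadraticForm K M)) (e j)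
      (contractLeft (Q := (0 : QuadraticForm K M)) (d j) t)) h0
    simp only [List.map_cons, List.prod_cons, mul_assoc, map_zero] at h1
    erw [contractLeft_ι_mul, contractLeft_ι_mul] at h1
    rw [hd] at h1
    simp only [hdz, hdy, if_true, one_smul, zero_smul, mul_zero, sub_zero] at h1
    erw [contractLeft_ι_mul] at h1
    rw [he] at h1
    simp only [hey, if_true, one_smul, mul_zero, sub_zero] at h1
    exact prod_ι_mul_ι_ne_zero z y d e hdz hdy hez hey L hL h1

end ExteriorAlgebra

/-! ### Top powers of `(1,1)`-forms and the volume form. -/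

namespace ChernForms

section

variable {n : ℕ} {X : Type*} [TopologicalSpace X] [ChartedSpace (Cn n) X]

/-- Grouping by rows writes the form as a sum of `n` decomposable two-forms `i dz_j ∧ (∑ a_jk
dz̄_k)`. These commute and square to zero, so the power is `n!` times their product, and the rows
contribute the determinant. -/
theorem form11_pow (x : X) (a : Matrix (Fin n) (Fin n) ℂ) :
    form11 (n := n) x a ^ n = ((n.factorial : ℂ) * a.det) • coordVol (n := n) x := by
  let z : Fin n → CotangentC (n := n) x := fun j => Complex.I • dz x j
  let y : Fin n → CotangentC (n := n) x := fun j => dzbar x j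
  have h1 : form11 (n := n) x a
      = ∑ j, ExteriorAlgebra.ι ℂ (z j) * ExteriorAlgebra.ι ℂ (∑ k, a j k • y k) := by
    simp only [form11, z, y, Finset.smul_sum, map_sum, map_smul, smul_mul_assoc, mul_smul_comm,
      Finset.mul_sum]
    exact Finset.sum_congr rfl fun j _ => Finset.sum_congr rfl fun k _ => smul_comm _ _ _
  have h2 : coordVol (n := n) x
      = (List.ofFn fun j => ExteriorAlgebra.ι ℂ (z j) * ExteriorAlgebra.ι ℂ (y j)).prod := by
    simp only [coordVol, z, y, map_smul, smul_mul_assoc]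
  rw [h1, h2, (sum_pow_of_commute_of_mul_self_eq_zero _
    (fun i j => ExteriorAlgebra.commute_ι_mul_ι _ _ _ _)
    (fun i => ExteriorAlgebra.ι_mul_ι_mul_self _ _)).1, ExteriorAlgebra.prod_ι_mul_ι_sum_smul,
    mul_smul, Nat.cast_smul_eq_nsmul]

/-- The vector with the single nonzero coordinate `c`, as a tangent vector. -/
noncomputable def tangentSingle (x : X) (j : Fin n) (c : ℂ) : TangentSpace 𝓘(ℂ, Cn n) x :=
  (EuclideanSpace.single j c : Cn n)

/-- The vectors `∂/∂z_j` (for `c = -i`) and `∂/∂z̄_j` (for `c = i`), as functionals on covectors. -/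
noncomputable def wirtingerDual (x : X) (c : ℂ) (j : Fin n) :
    Module.Dual ℂ (CotangentC (n := n) x) where
  toFun φ := (φ (tangentSingle x j 1) + c * φ (tangentSingle x j Complex.I)) / 2
  map_add' φ ψ := by simp only [LinearMap.add_apply]; ring
  map_smul' t φ := by simp only [LinearMap.smul_apply, smul_eq_mul, RingHom.id_apply]; ring

lemma dz_tangentSingle (x : X) (i j : Fin n) (c : ℂ) :
    dz x i (tangentSingle x j c) = if i = j then c else 0 := by
  change (EuclideanSpace.single j c : Cn n) i = _
  simp

lemma dzbar_tangentSingle (x : X) (i j : Fin n) (c : ℂ) :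
    dzbar x i (tangentSingle x j c) = if i = j then star c else 0 := by
  change star (dz x i (tangentSingle x j c)) = _
  rw [dz_tangentSingle]
  split_ifs <;> simp

lemma wirtingerDual_apply (x : X) (c : ℂ) (j : Fin n) (φ : CotangentC (n := n) x) :
    wirtingerDual x c j φ
      = (φ (tangentSingle x j 1) + c * φ (tangentSingle x j Complex.I)) / 2 := rfl

/-- This is what makes equality of `(n,n)`-forms equivalent to equality of their densities. -/
theorem coordVol_ne_zero (x : X) : coordVol (n := n) x ≠ 0 := by
  have h2 : coordVol (n := n) x
      = Complex.I ^ n • ((List.finRange n).map fun j => ExteriorAlgebra.ι ℂ (dz x j)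
        * ExteriorAlgebra.ι ℂ (dzbar x j)).prod := by
    rw [coordVol, List.ofFn_eq_map]
    have (L : List (Fin n)) : (L.map fun j => Complex.I • (ExteriorAlgebra.ι ℂ (dz x j)
        * ExteriorAlgebra.ι ℂ (dzbar x j))).prod = Complex.I ^ L.length •
          (L.map fun j => ExteriorAlgebra.ι ℂ (dz x j)
        * ExteriorAlgebra.ι ℂ (dzbar x j)).prod := by
      induction L with
      | nil => simp
      | cons j L ih =>
        simp only [List.map_cons, List.prod_cons, List.length_cons, ih]
        rw [smul_mul_smul_comm, pow_succ']
    rw [this, List.length_finRange]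
  rw [h2]
  refine smul_ne_zero (pow_ne_zero _ Complex.I_ne_zero) ?_
  refine ExteriorAlgebra.prod_ι_mul_ι_ne_zero _ _ (wirtingerDual x (-Complex.I))
    (wirtingerDual x Complex.I) ?_ ?_ ?_ ?_ _ (List.nodup_finRange n)
  all_goals
    intro i j
    simp only [wirtingerDual_apply, dz_tangentSingle, dzbar_tangentSingle, eq_comm (a := j)]
    split_ifs <;> simp

lemma smul_coordVol_inj (x : X) {s t : ℂ} :
    s • coordVol (n := n) x = t • coordVol (n := n) x ↔ s = t :=
  (smul_left_injective ℂ (coordVol_ne_zero x)).eq_iff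

end

end ChernForms

/-! ### Wirtinger calculus and the Chern curvature of a Gram matrix. -/

namespace ChernForms

open Filter Topology Matrix

section Wirtinger

variable {n : ℕ}

/-- The Wirtinger derivatives, `∂/∂z_j` for `c = -i` and `∂/∂z̄_j` for `c = i`. -/
noncomputable def wirtinger (c : ℂ) (j : Fin n) (f : Cn n → ℂ) (z : Cn n) : ℂ :=
  (fderiv ℝ f z (EuclideanSpace.single j 1)
    + c * fderiv ℝ f z (EuclideanSpace.single j Complex.I)) / 2

lemma dbyZ_eq_wirtinger (j : Fin n) : dbyZ j = wirtinger (n := n) (-Complex.I) j := by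
  funext f z
  simp only [dbyZ, wirtinger]
  ring

variable (c c' : ℂ) (j k : Fin n) {f g : Cn n → ℂ} {z : Cn n}

lemma _root_.Filter.EventuallyEq.wirtinger_eq (h : f =ᶠ[𝓝 z] g) :
    wirtinger c j f z = wirtinger c j g z := by
  simp only [wirtinger, h.fderiv_eq]

lemma _root_.Filter.EventuallyEq.wirtinger (h : f =ᶠ[𝓝 z] g) :
    wirtinger c j f =ᶠ[𝓝 z] wirtinger c j g :=
  h.eventuallyEq_nhds.mono fun _ hw => hw.wirtinger_eq c j

lemma wirtinger_mul (hf : DifferentiableAt ℝ f z) (hg : DifferentiableAt ℝ g z) :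
    wirtinger c j (fun w => f w * g w) z
      = wirtinger c j f z * g z + f z * wirtinger c j g z := by
  simp only [wirtinger, fderiv_fun_mul hf hg, _root_.add_apply,
    _root_.smul_apply, smul_eq_mul]
  ring

lemma wirtinger_sum {ι : Type*} (s : Finset ι) {f : ι → Cn n → ℂ}
    (hf : ∀ i ∈ s, DifferentiableAt ℝ (f i) z) :
    wirtinger c j (fun w => ∑ i ∈ s, f i w) z = ∑ i ∈ s, wirtinger c j (f i) z := by
  simp only [wirtinger, fderiv_fun_sum hf, _root_.sum_apply, Finset.mul_sum,
    ← Finset.sum_add_distrib, Finset.sum_div]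

lemma wirtinger_const_mul (a : ℂ) (hf : DifferentiableAt ℝ f z) :
    wirtinger c j (fun w => a * f w) z = a * wirtinger c j f z := by
  simp only [wirtinger, fderiv_const_mul hf, _root_.smul_apply, smul_eq_mul]
  ring

lemma wirtinger_prod {ι : Type*} [DecidableEq ι] (s : Finset ι) {f : ι → Cn n → ℂ}
    (hf : ∀ i ∈ s, DifferentiableAt ℝ (f i) z) :
    wirtinger c j (fun w => ∏ i ∈ s, f i w) z
      = ∑ i ∈ s, (∏ k ∈ s.erase i, f k z) * wirtinger c j (f i) z := by
  simp only [wirtinger, fderiv_finsetProd hf, _root_.sum_apply, Finset.mul_sum,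
    _root_.smul_apply, smul_eq_mul, ← Finset.sum_add_distrib, Finset.sum_div]
  exact Finset.sum_congr rfl fun i _ => by ring

lemma star_wirtinger (f : Cn n → ℂ) (z : Cn n) :
    star (wirtinger c j f z) = wirtinger (star c) j (fun w => star (f w)) z := by
  simp only [wirtinger, fderiv_star]
  simp

lemma _root_.ContDiffAt.differentiableAt_wirtinger (hf : ContDiffAt ℝ 2 f z) :
    DifferentiableAt ℝ (wirtinger c j f) z := by
  have h1 : DifferentiableAt ℝ (fderiv ℝ f) z :=
    (hf.fderiv_right (m := 1) (by norm_num)).differentiableAt (by norm_num)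
  unfold wirtinger
  fun_prop

/-- Both sides are the same combination of second real derivatives, by symmetry of the second
derivative. -/
lemma wirtinger_comm (hf : ContDiffAt ℝ 2 f z) :
    wirtinger c j (wirtinger c' k f) z = wirtinger c' k (wirtinger c j f) z := by
  have h1 : DifferentiableAt ℝ (fderiv ℝ f) z :=
    (hf.fderiv_right (m := 1) (by norm_num)).differentiableAt (by norm_num)
  have hs := hf.isSymmSndFDerivAt (by simp)
  have key : ∀ (c : ℂ) (k : Fin n) (u : Cn n), fderiv ℝ (wirtinger c k f) z u
      = (fderiv ℝ (fderiv ℝ f) z u (EuclideanSpace.single k 1)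
        + c * fderiv ℝ (fderiv ℝ f) z u (EuclideanSpace.single k Complex.I)) / 2 := by
    intro c k u
    have hv : ∀ v : Cn n, HasFDerivAt (fun w => fderiv ℝ f w v)
        ((ContinuousLinearMap.apply ℝ ℂ v).comp (fderiv ℝ (fderiv ℝ f) z)) z := fun v =>
      (ContinuousLinearMap.apply ℝ ℂ v).hasFDerivAt.comp z h1.hasFDerivAt
    have := (((hv (EuclideanSpace.single k 1)).add
      ((hv (EuclideanSpace.single k Complex.I)).const_mul c)).mul_const (2⁻¹ : ℂ)).fderiv
    have h2 : wirtinger c k f = fun w => (fderiv ℝ f w (EuclideanSpace.single k 1)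
      + c * fderiv ℝ f w (EuclideanSpace.single k Complex.I)) * 2⁻¹ := by
      funext w; simp only [wirtinger, div_eq_mul_inv]
    rw [h2]
    erw [this]
    simp
    ring
  rw [wirtinger, wirtinger, key, key, key, key]
  rw [hs (EuclideanSpace.single j 1) (EuclideanSpace.single k 1),
    hs (EuclideanSpace.single j 1) (EuclideanSpace.single k Complex.I),
    hs (EuclideanSpace.single j Complex.I) (EuclideanSpace.single k 1),
    hs (EuclideanSpace.single j Complex.I) (EuclideanSpace.single k Complex.I)]
  ring

end Wirtinger

section MatrixFunctions

variable {n m : ℕ} (c : ℂ) (j k : Fin n) {z : Cn n}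

/-- The entrywise Wirtinger derivative of a matrix-valued function. -/
noncomputable def matWirtinger (M : Cn n → Matrix (Fin m) (Fin m) ℂ) (z : Cn n) :
    Matrix (Fin m) (Fin m) ℂ :=
  of fun l p => wirtinger c j (fun w => M w l p) z

lemma matWirtinger_mul {M N : Cn n → Matrix (Fin m) (Fin m) ℂ}
    (hM : ∀ l p, DifferentiableAt ℝ (fun w => M w l p) z)
    (hN : ∀ l p, DifferentiableAt ℝ (fun w => N w l p) z) :
    matWirtinger c j (fun w => M w * N w) z
      = matWirtinger c j M z * N z + M z * matWirtinger c j N z := by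
  ext l p
  simp only [matWirtinger, of_apply, mul_apply, Matrix.add_apply]
  rw [wirtinger_sum c j Finset.univ fun i _ => (hM l i).fun_mul (hN i p), ← Finset.sum_add_distrib]
  exact Finset.sum_congr rfl fun i _ => wirtinger_mul c j (hM l i) (hN i p)

lemma differentiableAt_det {M : Cn n → Matrix (Fin m) (Fin m) ℂ}
    (hM : ∀ l p, DifferentiableAt ℝ (fun w => M w l p) z) :
    DifferentiableAt ℝ (fun w => (M w).det) z := by
  simp only [det_apply']
  fun_prop

lemma differentiableAt_inv {M : Cn n → Matrix (Fin m) (Fin m) ℂ}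
    (hM : ∀ l p, DifferentiableAt ℝ (fun w => M w l p) z) (h0 : (M z).det ≠ 0) (l p : Fin m) :
    DifferentiableAt ℝ (fun w => (M w)⁻¹ l p) z := by
  simp only [inv_def, Matrix.smul_apply, smul_eq_mul, Ring.inverse_eq_inv', adjugate_apply]
  refine ((differentiableAt_det hM).inv h0).fun_mul (differentiableAt_det fun a b => ?_)
  simp only [updateRow_apply]
  split_ifs
  · exact differentiableAt_const _
  · exact hM a b

/-- Jacobi's formula. -/
lemma wirtinger_det {M : Cn n → Matrix (Fin m) (Fin m) ℂ}
    (hM : ∀ l p, DifferentiableAt ℝ (fun w => M w l p) z) :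
    wirtinger c j (fun w => (M w).det) z = (adjugate (M z) * matWirtinger c j M z).trace := by
  -- By Cramer's rule the trace is the sum of the determinants in which one column is replaced by
  -- its derivative; this is matched with the Leibniz rule in the permutation expansion.
  have h1 : (adjugate (M z) * matWirtinger c j M z).trace
      = ∑ i, ((M z).updateCol i fun l => matWirtinger c j M z l i).det := by
    refine Finset.sum_congr rfl fun i _ => ?_
    rw [← cramer_apply, cramer_eq_adjugate_mulVec]
    rfl
  have h2 : ∀ i, ((M z).updateCol i fun l => matWirtinger c j M z l i).det
      = ∑ σ : Equiv.Perm (Fin m), ((Equiv.Perm.sign σ : ℤ) : ℂ) *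
        ((∏ k ∈ Finset.univ.erase i, M z (σ k) k) * matWirtinger c j M z (σ i) i) := by
    intro i
    rw [det_apply']
    refine Finset.sum_congr rfl fun σ _ => ?_
    rw [← Finset.prod_erase_mul _ _ (Finset.mem_univ i), updateCol_self]
    congr 2
    exact Finset.prod_congr rfl fun k hk => updateCol_ne (Finset.ne_of_mem_erase hk)
  rw [h1]
  simp only [h2]
  rw [Finset.sum_comm]
  simp only [det_apply']
  rw [wirtinger_sum c j Finset.univ fun σ _ => by fun_prop]
  refine Finset.sum_congr rfl fun σ _ => ?_
  rw [wirtinger_const_mul c j _ (by fun_prop), wirtinger_prod c j _ fun i _ => hM _ _,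
    Finset.mul_sum]
  rfl

end MatrixFunctions

section Curvature

variable {n m : ℕ} {H : Cn n → Matrix (Fin m) (Fin m) ℂ} {z : Cn n}

lemma chernConnection_eq (H : Cn n → Matrix (Fin m) (Fin m) ℂ) (j : Fin n) (z : Cn n) :
    chernConnection H j z = matWirtinger (-Complex.I) j H z * (H z)⁻¹ := by
  rw [chernConnection, dbyZ_eq_wirtinger]; rfl

lemma chernCurvature_eq (H : Cn n → Matrix (Fin m) (Fin m) ℂ) (j k : Fin n) (z : Cn n) :
    chernCurvature H j k z = -matWirtinger Complex.I k (chernConnection H j) z := by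
  ext; rfl

lemma differentiableAt_chernConnection (hH : ∀ l p, ContDiffAt ℝ 2 (fun w => H w l p) z)
    (h0 : (H z).det ≠ 0) (j : Fin n) (l p : Fin m) :
    DifferentiableAt ℝ (fun w => chernConnection H j w l p) z := by
  simp only [chernConnection_eq, mul_apply]
  refine DifferentiableAt.fun_sum fun i _ => DifferentiableAt.fun_mul ?_ ?_
  · exact (hH l i).differentiableAt_wirtinger _ _
  · exact differentiableAt_inv (fun a b => (hH a b).differentiableAt (by norm_num)) h0 i p

/-- Applying `∂̄_k` to `A_j H = ∂_j H` avoids differentiating `H⁻¹`. The resulting expression makes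
the hermitian symmetry visible. -/
lemma chernCurvature_mul (hH : ∀ l p, ContDiffAt ℝ 2 (fun w => H w l p) z)
    (h0 : ∀ᶠ w in 𝓝 z, (H w).det ≠ 0) (j k : Fin n) :
    chernCurvature H j k z * H z
      = -matWirtinger Complex.I k (matWirtinger (-Complex.I) j H) z
        + matWirtinger (-Complex.I) j H z * (H z)⁻¹ * matWirtinger Complex.I k H z := by
  have hd := fun a b => (hH a b).differentiableAt (n := 2) (by norm_num)
  have h1 : matWirtinger Complex.I k (fun w => chernConnection H j w * H w) z
      = matWirtinger Complex.I k (matWirtinger (-Complex.I) j H) z := by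
    ext l p
    refine EventuallyEq.wirtinger_eq _ _ (h0.mono fun w hw => ?_)
    simp only
    rw [chernConnection_eq, mul_assoc, nonsing_inv_mul _ (isUnit_iff_ne_zero.2 hw), mul_one]
  rw [matWirtinger_mul _ _ (differentiableAt_chernConnection hH h0.self_of_nhds j) hd] at h1
  rw [← h1, chernCurvature_eq, chernConnection_eq H j z]
  noncomm_ring

/-- The curvature is hermitian. -/
theorem conjTranspose_chernCurvature_mul (hH : ∀ l p, ContDiffAt ℝ 2 (fun w => H w l p) z)
    (h0 : ∀ᶠ w in 𝓝 z, (H w).det ≠ 0) (hs : ∀ᶠ w in 𝓝 z, (H w).IsHermitian) (j k : Fin n) :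
    (chernCurvature H j k z * H z)ᴴ = chernCurvature H k j z * H z := by
  have hent : ∀ l p, (fun w => star (H w l p)) =ᶠ[𝓝 z] fun w => H w p l := fun l p =>
    hs.mono fun w hw => hw.apply p l
  have h1 : ∀ c j, (matWirtinger c j H z)ᴴ = matWirtinger (star c) j H z := by
    intro c j
    ext l p
    simp only [conjTranspose_apply, matWirtinger, of_apply, star_wirtinger]
    exact (hent p l).wirtinger_eq _ _
  -- Conjugation exchanges `∂` and `∂̄`; commuting them restores the order with `j` and `k` swapped.
  have h2 : (matWirtinger Complex.I k (matWirtinger (-Complex.I) j H) z)ᴴ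
      = matWirtinger Complex.I j (matWirtinger (-Complex.I) k H) z := by
    ext l p
    simp only [conjTranspose_apply, matWirtinger, of_apply, star_wirtinger]
    have := ((hent p l).wirtinger (star (-Complex.I)) j).wirtinger_eq (star Complex.I) k
    refine this.trans ?_
    have h3 : star Complex.I = -Complex.I := Complex.conj_I
    have h4 : star (-Complex.I) = Complex.I := by rw [star_neg, h3, neg_neg]
    rw [h3, h4]
    exact wirtinger_comm _ _ _ _ (hH l p)
  have h3 : star Complex.I = -Complex.I := Complex.conj_I
  rw [chernCurvature_mul hH h0, chernCurvature_mul hH h0, conjTranspose_add, conjTranspose_neg, h2,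
    conjTranspose_mul, conjTranspose_mul, conjTranspose_nonsing_inv, hs.self_of_nhds.eq, h1, h1,
    star_neg, h3, neg_neg, mul_assoc]

/-- The curvature of the determinant is the trace of the curvature. -/
theorem chernCurvature_det (hH : ∀ l p, ContDiffAt ℝ 2 (fun w => H w l p) z)
    (h0 : ∀ᶠ w in 𝓝 z, (H w).det ≠ 0) (j k : Fin n) :
    chernCurvature (m := 1) (fun w => Matrix.of fun _ _ => (H w).det) j k z 0 0
      = (chernCurvature H j k z).trace := by
  have hd : ∀ᶠ w in 𝓝 z, ∀ a b, DifferentiableAt ℝ (fun w => H w a b) w := by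
    simp only [eventually_all]
    intro a b
    exact ((hH a b).eventually (by simp)).mono fun w hw => hw.differentiableAt (by norm_num)
  -- Jacobi's formula gives `∂(det H) / det H = tr(∂H H⁻¹)`. It is needed on a neighbourhood because
  -- it is differentiated once more.
  have h1 : (fun w => chernConnection (m := 1) (fun w => Matrix.of fun _ _ => (H w).det) j w 0 0)
      =ᶠ[𝓝 z] fun w => ∑ l, chernConnection H j w l l := by
    filter_upwards [h0, hd] with w hw hdw
    have h2 : ((of fun _ _ => (H w).det : Matrix (Fin 1) (Fin 1) ℂ)⁻¹) 0 0 = ((H w).det)⁻¹ := by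
      simp
    rw [chernConnection, mul_apply, Fin.sum_univ_one, h2, of_apply, dbyZ_eq_wirtinger]
    simp only [of_apply]
    rw [wirtinger_det _ _ hdw]
    change _ = (chernConnection H j w).trace
    rw [chernConnection_eq, inv_def, Ring.inverse_eq_inv', mul_smul_comm, trace_smul, trace_mul_comm,
      smul_eq_mul, mul_comm]
  have h3 : chernCurvature (m := 1) (fun w => Matrix.of fun _ _ => (H w).det) j k z 0 0
      = -wirtinger Complex.I k (fun w => ∑ l, chernConnection H j w l l) z := by
    rw [← h1.wirtinger_eq]; rfl
  rw [h3, wirtinger_sum _ _ Finset.univ fun l _ =>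
    differentiableAt_chernConnection hH h0.self_of_nhds j l l, ← Finset.sum_neg_distrib]
  rfl

end Curvature

end ChernForms

/-! ### Positivity of hermitian forms and the determinant inequality with its `r`-th root. -/

section QuadraticForms

open Matrix
open scoped ComplexOrder Kronecker

/-- The sum is the usual hermitian form evaluated at `star γ`, and conjugation permutes the nonzero
vectors. Hermitian symmetry makes its imaginary part vanish, so the real part decides. -/
lemma Matrix.IsHermitian.posDef_iff_re_sum {ι : Type*} [Fintype ι] {M : Matrix ι ι ℂ}
    (hM : M.IsHermitian) :
    M.PosDef ↔ ∀ γ : ι → ℂ, γ ≠ 0 → 0 < (∑ a, ∑ b, M a b * γ a * star (γ b)).re := by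
  have key : ∀ γ : ι → ℂ, ∑ a, ∑ b, M a b * γ a * star (γ b) = γ ⬝ᵥ (M *ᵥ star γ) := by
    intro γ
    simp only [dotProduct, mulVec, Pi.star_apply, Finset.mul_sum]
    exact Finset.sum_congr rfl fun a _ => Finset.sum_congr rfl fun b _ => by ring
  simp only [key]
  rw [posDef_iff_dotProduct_mulVec]
  constructor
  · rintro ⟨-, h⟩ γ hγ
    have := h (x := star γ) (star_ne_zero.2 hγ)
    rw [star_star] at this
    exact (Complex.lt_def.1 this).1
  · refine fun h => ⟨hM, fun {γ} hγ => ?_⟩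
    have := h (star γ) (star_ne_zero.2 hγ)
    rw [star_star] at this
    exact Complex.lt_def.2 ⟨this, (hM.im_star_dotProduct_mulVec_self γ).symm⟩

lemma Matrix.IsHermitian.posDef_iff_re_sum_prod {n r : ℕ}
    {M : Matrix (Fin n × Fin r) (Fin n × Fin r) ℂ} (hM : M.IsHermitian) :
    M.PosDef ↔ ∀ γ : Fin n → Fin r → ℂ, γ ≠ 0 →
      0 < (∑ j, ∑ k, ∑ l, ∑ m, M (j, l) (k, m) * γ j l * star (γ k m)).re := by
  rw [hM.posDef_iff_re_sum]
  have key : ∀ γ : Fin n → Fin r → ℂ,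
      ∑ j, ∑ k, ∑ l, ∑ m, M (j, l) (k, m) * γ j l * star (γ k m)
        = ∑ a, ∑ b, M a b * Function.uncurry γ a * star (Function.uncurry γ b) := by
    intro γ
    simp only [Fintype.sum_prod_type, Function.uncurry_apply_pair]
    exact Finset.sum_congr rfl fun j _ => Finset.sum_comm
  simp only [key]
  constructor
  · refine fun h γ hγ => h _ fun h0 => hγ ?_
    funext j l
    exact congrFun h0 (j, l)
  · refine fun h γ hγ => ?_
    have := h (Function.curry γ) fun h0 => hγ ?_
    · simpa using this
    · funext a
      exact congrFun (congrFun h0 a.1) a.2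

lemma Matrix.IsHermitian.coe_re_det {ι : Type*} [Fintype ι] [DecidableEq ι] {M : Matrix ι ι ℂ}
    (hM : M.IsHermitian) : (M.det.re : ℂ) = M.det := by
  rw [← Complex.conj_eq_iff_re]
  conv_rhs => rw [← hM.eq, det_conjTranspose]
  rfl

/-- The determinant inequality and its equality case for positive matrices with given partial
trace. -/
lemma Matrix.PosDef.rpow_re_det_le {n r : ℕ} (hr : 0 < r)
    {C : Matrix (Fin n × Fin r) (Fin n × Fin r) ℂ} (hC : C.PosDef) :
    C.det.re ^ (1 / (r : ℝ)) ≤ ((r : ℂ)⁻¹ • Matrix.partialTrace C).det.re := by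
  have : Nonempty (Fin r) := ⟨⟨0, hr⟩⟩
  have hS := (hC.partialTrace.inv_smul_nat hr).re_det_pos
  have h := hC.re_det_le_partialTrace
  simp only [Fintype.card_fin] at h
  calc C.det.re ^ (1 / (r : ℝ))
      ≤ (((r : ℂ)⁻¹ • Matrix.partialTrace C).det.re ^ r) ^ (1 / (r : ℝ)) :=
        Real.rpow_le_rpow hC.re_det_pos.le h (by positivity)
    _ = _ := by rw [one_div, Real.pow_rpow_inv_natCast hS.le hr.ne']

/-- Positivity is part of both sides: that of `C` passes to its partial trace, and conversely that
of `T` gives back that of `(T/r) ⊗ 1`. -/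
lemma Matrix.posDef_and_rpow_re_det_eq_iff {n r : ℕ} (hr : 0 < r)
    {C : Matrix (Fin n × Fin r) (Fin n × Fin r) ℂ} :
    (C.PosDef ∧ C.det.re ^ (1 / (r : ℝ)) = ((r : ℂ)⁻¹ • partialTrace C).det.re) ↔
      C = ((r : ℂ)⁻¹ • partialTrace C) ⊗ₖ (1 : Matrix (Fin r) (Fin r) ℂ) ∧
        (partialTrace C).PosDef := by
  have : Nonempty (Fin r) := ⟨⟨0, hr⟩⟩
  constructor
  · rintro ⟨hC, heq⟩
    refine ⟨?_, hC.partialTrace⟩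
    have h := hC.eq_kronecker_of_le_re_det
    simp only [Fintype.card_fin] at h
    refine h ?_
    rw [← heq, one_div, Real.rpow_inv_natCast_pow hC.re_det_pos.le hr.ne']
  · rintro ⟨hC, hT⟩
    have hS := hT.inv_smul_nat hr
    have hdet := hS.re_det_kronecker_one (κ := Fin r)
    rw [← hC, Fintype.card_fin] at hdet
    refine ⟨hC ▸ hS.kronecker PosDef.one, ?_⟩
    rw [hdet, one_div, Real.pow_rpow_inv_natCast hS.re_det_pos.le hr.ne']

end QuadraticForms

namespace ChernForms

open Matrix
open scoped ComplexOrder Kronecker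

section Volumes

variable {n : ℕ} {X : Type*} [TopologicalSpace X] [ChartedSpace (Cn n) X]

lemma volLE_smul_coordVol (x : X) {s t : ℝ} (h : s ≤ t) :
    VolLE (n := n) x ((s : ℂ) • coordVol (n := n) x) ((t : ℂ) • coordVol (n := n) x) :=
  ⟨t - s, sub_nonneg.2 h, by rw [← add_smul]; push_cast; congr 1; ring⟩

end Volumes

/-! ### Curvature tensors on a single hermitian vector space. -/

section Pointwise

variable {n r : ℕ} {V : Type*} [NormedAddCommGroup V] [InnerProductSpace ℂ V]

/-- The matrix of the `(1,1)`-form `⟨Θ ⬝ v, v⟩`. -/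
noncomputable def quadMatrix (Θ : Fin n → Fin n → V →ₗ[ℂ] V) (v : V) : Matrix (Fin n) (Fin n) ℂ :=
  of fun j k => inner ℂ v (Θ j k v)

/-- The matrix of the trace of `Θ`. -/
noncomputable def traceMatrix (Θ : Fin n → Fin n → V →ₗ[ℂ] V) : Matrix (Fin n) (Fin n) ℂ :=
  of fun j k => LinearMap.trace ℂ V (Θ j k)

/-- The matrix of the hermitian form on `T ⊗ V` associated with `Θ`. -/
noncomputable def nakanoMatrix (u : OrthonormalBasis (Fin r) ℂ V)
    (Θ : Fin n → Fin n → V →ₗ[ℂ] V) : Matrix (Fin n × Fin r) (Fin n × Fin r) ℂ :=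
  of fun a b => inner ℂ (u b.2) (Θ a.1 b.1 (u a.2))

/-- The matrix of the hermitian form on `T ⊗ V^*` associated with `Θ`. -/
noncomputable def dualNakanoMatrix (u : OrthonormalBasis (Fin r) ℂ V)
    (Θ : Fin n → Fin n → V →ₗ[ℂ] V) : Matrix (Fin n × Fin r) (Fin n × Fin r) ℂ :=
  of fun a b => inner ℂ (u a.2) (Θ a.1 b.1 (u b.2))

variable {u : OrthonormalBasis (Fin r) ℂ V} {Θ : Fin n → Fin n → V →ₗ[ℂ] V}

lemma partialTrace_nakanoMatrix : partialTrace (nakanoMatrix u Θ) = traceMatrix Θ := by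
  ext j k
  simp [partialTrace, nakanoMatrix, traceMatrix, LinearMap.trace_eq_sum_inner _ u]

lemma partialTrace_dualNakanoMatrix : partialTrace (dualNakanoMatrix u Θ) = traceMatrix Θ := by
  ext j k
  simp [partialTrace, dualNakanoMatrix, traceMatrix, LinearMap.trace_eq_sum_inner _ u]

lemma sum_quadMatrix (u : OrthonormalBasis (Fin r) ℂ V) :
    ∑ l, quadMatrix Θ (u l) = traceMatrix Θ := by
  ext j k
  simp [quadMatrix, traceMatrix, LinearMap.trace_eq_sum_inner _ u, Matrix.sum_apply]

section Hermitian

variable (hΘ : ∀ j k v w, inner ℂ w (Θ j k v) = inner ℂ (Θ k j w) v)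

include hΘ

lemma isHermitian_nakanoMatrix : (nakanoMatrix u Θ).IsHermitian := by
  ext a b
  simp only [conjTranspose_apply, nakanoMatrix, of_apply, hΘ a.1 b.1]
  exact inner_conj_symm _ _

lemma isHermitian_dualNakanoMatrix : (dualNakanoMatrix u Θ).IsHermitian := by
  ext a b
  simp only [conjTranspose_apply, dualNakanoMatrix, of_apply, hΘ a.1 b.1]
  exact inner_conj_symm _ _

lemma isHermitian_quadMatrix (v : V) : (quadMatrix Θ v).IsHermitian := by
  ext j k
  simp only [conjTranspose_apply, quadMatrix, of_apply, hΘ j k]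
  exact inner_conj_symm _ _

lemma isHermitian_traceMatrix (u : OrthonormalBasis (Fin r) ℂ V) :
    (traceMatrix Θ).IsHermitian := by
  rw [← sum_quadMatrix u, IsHermitian, conjTranspose_sum]
  exact Finset.sum_congr rfl fun l _ => isHermitian_quadMatrix hΘ (u l)

end Hermitian

/-- `Θ` is a multiple of the identity. -/
def IsScalarCurvature (r : ℕ) (Θ : Fin n → Fin n → V →ₗ[ℂ] V) : Prop :=
  ∀ j k, Θ j k = ((r : ℂ)⁻¹ * traceMatrix Θ j k) • LinearMap.id

/-- Taking traces forces the scalar to be the trace divided by `r`. -/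
lemma isScalarCurvature_of_eq_smul (hr : 0 < r) (u : OrthonormalBasis (Fin r) ℂ V)
    {a : Fin n → Fin n → ℂ} (h : ∀ j k, Θ j k = a j k • LinearMap.id) :
    IsScalarCurvature r Θ := by
  intro j k
  have h0 : (r : ℂ) ≠ 0 := by exact_mod_cast hr.ne'
  have : traceMatrix Θ j k = r * a j k := by
    simp [traceMatrix, h, LinearMap.trace_eq_sum_inner _ u, inner_smul_right]
  rw [this, inv_mul_cancel_left₀ h0, h]

lemma isScalarCurvature_iff_forall_inner (u : OrthonormalBasis (Fin r) ℂ V) :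
    IsScalarCurvature r Θ ↔ ∀ j k l m,
      inner ℂ (u m) (Θ j k (u l)) = if l = m then (r : ℂ)⁻¹ * traceMatrix Θ j k else 0 := by
  constructor
  · intro h j k l m
    rw [h j k, LinearMap.smul_apply, LinearMap.id_apply, inner_smul_right,
      orthonormal_iff_ite.1 u.orthonormal]
    by_cases hlm : l = m
    · simp [hlm]
    · simp [hlm, Ne.symm hlm]
  · intro h j k
    refine u.toBasis.ext fun l => ?_
    refine InnerProductSpace.ext_inner_left_basis u.toBasis fun m => ?_
    simp only [OrthonormalBasis.coe_toBasis, LinearMap.smul_apply, LinearMap.id_apply,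
      inner_smul_right, orthonormal_iff_ite.1 u.orthonormal, h]
    by_cases hlm : l = m
    · simp [hlm]
    · simp [hlm, Ne.symm hlm]

lemma isScalarCurvature_iff_nakanoMatrix : IsScalarCurvature r Θ ↔
    nakanoMatrix u Θ = ((r : ℂ)⁻¹ • partialTrace (nakanoMatrix u Θ)) ⊗ₖ 1 := by
  rw [isScalarCurvature_iff_forall_inner u, partialTrace_nakanoMatrix]
  constructor
  · rintro h
    ext ⟨j, l⟩ ⟨k, m⟩
    simp [nakanoMatrix, h, one_apply]
  · intro h j k l m
    have := congrFun (congrFun h (j, l)) (k, m)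
    simpa [nakanoMatrix, one_apply] using this

lemma isScalarCurvature_iff_dualNakanoMatrix : IsScalarCurvature r Θ ↔
    dualNakanoMatrix u Θ = ((r : ℂ)⁻¹ • partialTrace (dualNakanoMatrix u Θ)) ⊗ₖ 1 := by
  rw [isScalarCurvature_iff_forall_inner u, partialTrace_dualNakanoMatrix]
  constructor
  · rintro h
    ext ⟨j, l⟩ ⟨k, m⟩
    simp [dualNakanoMatrix, h, one_apply, eq_comm]
  · intro h j k l m
    -- The fibre indices are exchanged relative to the Nakano matrix, which is harmless as the
    -- identity matrix is symmetric.
    have := congrFun (congrFun h (j, m)) (k, l)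
    simpa [dualNakanoMatrix, one_apply, eq_comm] using this

lemma IsScalarCurvature.quadMatrix_eq (h : IsScalarCurvature r Θ) (v : V) :
    quadMatrix Θ v = ((‖v‖ : ℂ) ^ 2) • ((r : ℂ)⁻¹ • traceMatrix Θ) := by
  ext j k
  simp only [quadMatrix, of_apply, Matrix.smul_apply, smul_eq_mul]
  rw [h j k, LinearMap.smul_apply, LinearMap.id_apply, inner_smul_right,
    inner_self_eq_norm_sq_to_K, mul_comm]
  rfl

/-- After subtracting the scalar part, the quadratic form vanishes on unit vectors, hence everywhere
by scaling; over `ℂ`, polarization then makes the endomorphism zero. -/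
lemma isScalarCurvature_of_quadMatrix
    (h : ∀ v : V, ‖v‖ = 1 → quadMatrix Θ v = (r : ℂ)⁻¹ • traceMatrix Θ) :
    IsScalarCurvature r Θ := by
  intro j k
  rw [← sub_eq_zero, ← inner_map_self_eq_zero]
  intro v
  rw [← inner_conj_symm]
  suffices inner ℂ v ((Θ j k - ((r : ℂ)⁻¹ * traceMatrix Θ j k) • (LinearMap.id : V →ₗ[ℂ] V)) v) = 0 by
    rw [this, map_zero]
  rcases eq_or_ne v 0 with rfl | hv
  · simp
  have hv' : (‖v‖ : ℂ) ≠ 0 := by simpa using hv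
  have hw : ‖(‖v‖ : ℂ)⁻¹ • v‖ = 1 := by
    rw [norm_smul, norm_inv, Complex.norm_real, norm_norm, inv_mul_cancel₀ (norm_ne_zero_iff.2 hv)]
  obtain ⟨w, hwv⟩ : ∃ w, w = (‖v‖ : ℂ)⁻¹ • v := ⟨_, rfl⟩
  rw [← hwv] at hw
  have hv2 : v = (‖v‖ : ℂ) • w := by rw [hwv, smul_inv_smul₀ hv']
  have h1 := congrFun (congrFun (h w hw) j) k
  simp only [quadMatrix, of_apply, Matrix.smul_apply, smul_eq_mul] at h1
  rw [hv2, map_smul, inner_smul_left, inner_smul_right, LinearMap.sub_apply, LinearMap.smul_apply,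
    LinearMap.id_apply, inner_sub_right, h1, inner_smul_right, inner_self_eq_norm_sq_to_K, hw]
  simp

lemma exists_orthonormalBasis_apply_eq (u : OrthonormalBasis (Fin r) ℂ V) {v : V}
    (hv : ‖v‖ = 1) (i : Fin r) : ∃ b : OrthonormalBasis (Fin r) ℂ V, b i = v := by
  have := u.toBasis.finiteDimensional_of_finite
  obtain ⟨b, hb⟩ := Orthonormal.exists_orthonormalBasis_extension_of_card_eq (𝕜 := ℂ)
    (Module.finrank_eq_card_basis u.toBasis) (v := fun _ : Fin r => v) (s := {i})
    ⟨fun _ => hv, fun a b hab => (hab (Subsingleton.elim a b)).elim⟩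
  exact ⟨b, hb i rfl⟩

/-- The values of the determinants of `⟨Θ ⬝ v, v⟩` on unit vectors. -/
def unitDets (Θ : Fin n → Fin n → V →ₗ[ℂ] V) : Set ℝ :=
  {t | ∃ v : V, ‖v‖ = 1 ∧ (quadMatrix Θ v).det.re = t}

lemma unitDets_bddBelow (h : ∀ v : V, v ≠ 0 → (quadMatrix Θ v).PosDef) :
    BddBelow (unitDets Θ) := by
  refine ⟨0, ?_⟩
  rintro t ⟨v, hv, rfl⟩
  exact (h v (norm_ne_zero_iff.1 (by rw [hv]; exact one_ne_zero))).re_det_pos.le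

lemma sInf_unitDets_le (hr : 0 < r) (u : OrthonormalBasis (Fin r) ℂ V)
    (h : ∀ v : V, v ≠ 0 → (quadMatrix Θ v).PosDef) :
    sInf (unitDets Θ) ≤ ((r : ℂ)⁻¹ • traceMatrix Θ).det.re := by
  have : Nonempty (Fin r) := ⟨⟨0, hr⟩⟩
  obtain ⟨l, hl⟩ := exists_re_det_le_mean fun l => h (u l) (u.orthonormal.ne_zero l)
  rw [sum_quadMatrix, Fintype.card_fin] at hl
  exact (csInf_le (unitDets_bddBelow h) ⟨u l, u.orthonormal.1 l, rfl⟩).trans hl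

lemma posDef_traceMatrix (hr : 0 < r) (u : OrthonormalBasis (Fin r) ℂ V)
    (h : ∀ v : V, v ≠ 0 → (quadMatrix Θ v).PosDef) : (traceMatrix Θ).PosDef := by
  have : Nonempty (Fin r) := ⟨⟨0, hr⟩⟩
  rw [← sum_quadMatrix u]
  exact posDef_sum Finset.univ_nonempty fun l _ => h (u l) (u.orthonormal.ne_zero l)

lemma posDef_and_sInf_unitDets_eq_iff (hr : 0 < r) (u : OrthonormalBasis (Fin r) ℂ V) :
    ((∀ v : V, v ≠ 0 → (quadMatrix Θ v).PosDef) ∧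
      sInf (unitDets Θ) = ((r : ℂ)⁻¹ • traceMatrix Θ).det.re) ↔
        IsScalarCurvature r Θ ∧ (traceMatrix Θ).PosDef := by
  have : Nonempty (Fin r) := ⟨⟨0, hr⟩⟩
  constructor
  · rintro ⟨h, heq⟩
    refine ⟨isScalarCurvature_of_quadMatrix fun v hv => ?_, posDef_traceMatrix hr u h⟩
    -- The equality case concerns a whole orthonormal basis, so the arbitrary unit vector `v` is
    -- completed to one. All its determinants are at least the infimum, which is the determinant of
    -- the mean.
    obtain ⟨b, rfl⟩ := exists_orthonormalBasis_apply_eq u hv ⟨0, hr⟩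
    have := eq_mean_of_le_re_det (fun l => h (b l) (b.orthonormal.ne_zero l)) (fun l => ?_) ⟨0, hr⟩
    · rwa [sum_quadMatrix, Fintype.card_fin] at this
    · rw [sum_quadMatrix, Fintype.card_fin, ← heq]
      exact csInf_le (unitDets_bddBelow h) ⟨b l, b.orthonormal.1 l, rfl⟩
  · rintro ⟨h, hT⟩
    refine ⟨fun v hv => ?_, ?_⟩
    · rw [h.quadMatrix_eq]
      refine (hT.inv_smul_nat hr).smul ?_
      exact_mod_cast pow_pos (norm_pos_iff.2 hv) 2
    -- For scalar curvature the matrix is the same at every unit vector; `0 < r` ensures that there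
    -- is one, so the infimum is not over the empty set.
    · have : unitDets Θ = {((r : ℂ)⁻¹ • traceMatrix Θ).det.re} := by
        ext t
        constructor
        · rintro ⟨v, hv, rfl⟩
          rw [h.quadMatrix_eq, hv]
          simp
        · rintro rfl
          refine ⟨u ⟨0, hr⟩, u.orthonormal.1 _, ?_⟩
          rw [h.quadMatrix_eq, u.orthonormal.1]
          simp
      rw [this, csInf_singleton]

end Pointwise

end ChernForms

/-! ### From the bundle to pointwise linear algebra. -/

namespace ChernForms

open Filter Topology Matrix
open scoped ComplexOrder Kronecker

section Gram

variable {n r : ℕ} {X : Type*} [TopologicalSpace X] [ChartedSpace (Cn n) X]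
  (E : X → Type*) [TopologicalSpace (TotalSpace (Cn r) E)]
  [∀ x, NormedAddCommGroup (E x)] [∀ x, InnerProductSpace ℂ (E x)]
  [FiberBundle (Cn r) E] [VectorBundle ℂ (Cn r) E]

lemma isHermitian_gram (x : X) (z : Cn n) : (gram (r := r) E x z).IsHermitian := by
  ext l m
  simp only [conjTranspose_apply, gram, of_apply]
  exact inner_conj_symm _ _

lemma det_gram_ne_zero (x : X) (z : Cn n)
    (hz : (chartAt (Cn n) x).symm z ∈ (trivializationAt (Cn r) E x).baseSet) :
    (gram (r := r) E x z).det ≠ 0 := by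
  have h : gram (r := r) E x z = (Matrix.gram ℂ ((trivializationAt (Cn r) E x).basisAt
      (EuclideanSpace.basisFun (Fin r) ℂ).toBasis hz))ᵀ := by
    ext l m
    simp only [gram, of_apply, transpose_apply, Matrix.gram_apply]
    rw [Trivialization.localFrame_apply_of_mem_baseSet _ _ hz,
      Trivialization.localFrame_apply_of_mem_baseSet _ _ hz]
  rw [h, det_transpose]
  exact (posDef_gram_of_linearIndependent (Module.Basis.linearIndependent _)).det_pos.ne'

lemma gram_chartAt (x : X) (l m : Fin r) : gram E x (chartAt (Cn n) x x) l m
    = inner ℂ (fiberBasis r E x m) (fiberBasis r E x l) := by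
  -- The chart inverse returns `x` only up to a propositional equality, and the fibre depends on the
  -- point; generalizing over `p` permits the substitution.
  have key : ∀ p (hp : p = x),
      (inner ℂ ((trivializationAt (Cn r) E x).localFrame
          (EuclideanSpace.basisFun (Fin r) ℂ).toBasis m p)
        ((trivializationAt (Cn r) E x).localFrame
          (EuclideanSpace.basisFun (Fin r) ℂ).toBasis l p) : ℂ)
        = inner ℂ (fiberBasis r E x m) (fiberBasis r E x l) := by
    intro p hp
    subst hp
    rw [Trivialization.localFrame_apply_of_mem_baseSet _ _ (mem_baseSet_trivializationAt (Cn r) E p),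
      Trivialization.localFrame_apply_of_mem_baseSet _ _ (mem_baseSet_trivializationAt (Cn r) E p)]
    rfl
  exact key _ ((chartAt (Cn n) x).left_inv (mem_chart_source _ x))

omit [∀ x, InnerProductSpace ℂ (E x)] [VectorBundle ℂ (Cn r) E] in
lemma chartAt_target_inter_mem_nhds (x : X) :
    (chartAt (Cn n) x).target ∩
      (chartAt (Cn n) x).symm ⁻¹' (trivializationAt (Cn r) E x).baseSet
        ∈ 𝓝 (chartAt (Cn n) x x) := by
  refine ((chartAt (Cn n) x).isOpen_inter_preimage_symm
    (trivializationAt (Cn r) E x).open_baseSet).mem_nhds ⟨mem_chart_target _ x, ?_⟩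
  rw [Set.mem_preimage, (chartAt (Cn n) x).left_inv (mem_chart_source _ x)]
  exact mem_baseSet_trivializationAt (Cn r) E x

lemma eventually_det_gram_ne_zero (x : X) :
    ∀ᶠ z in 𝓝 (chartAt (Cn n) x x), (gram (r := r) E x z).det ≠ 0 :=
  mem_of_superset (chartAt_target_inter_mem_nhds E x) fun z hz => det_gram_ne_zero E x z hz.2

variable {E}

lemma IsSmoothMetric.contDiffAt (hh : IsSmoothMetric n r E) (x : X) (l m : Fin r) :
    ContDiffAt ℝ 2 (fun z : Cn n => gram (r := r) E x z l m) (chartAt (Cn n) x x) :=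
  ((hh x l m).contDiffAt (chartAt_target_inter_mem_nhds E x)).of_le (WithTop.coe_le_coe.2 le_top)

lemma inner_curvEnd_fiberBasis (x : X) (j k : Fin n) (l m : Fin r) :
    inner ℂ (fiberBasis r E x m) (curvEnd r E x j k (fiberBasis r E x l))
      = (chernCurvature (gram (r := r) E x) j k (chartAt (Cn n) x x)
          * gram (r := r) E x (chartAt (Cn n) x x)) l m := by
  rw [curvEnd, Matrix.toLin_self, inner_sum, mul_apply]
  refine Finset.sum_congr rfl fun p _ => ?_
  rw [inner_smul_right, gram_chartAt, transpose_apply]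

/-- The curvature is hermitian. -/
theorem inner_curvEnd (hh : IsSmoothMetric n r E) (x : X) (j k : Fin n) (v w : E x) :
    inner ℂ w (curvEnd r E x j k v) = inner ℂ (curvEnd r E x k j w) v := by
  have : FiniteDimensional ℂ (E x) := (fiberBasis r E x).finiteDimensional_of_finite
  have h : curvEnd r E x k j = (curvEnd r E x j k).adjoint := by
    rw [LinearMap.eq_adjoint_iff_basis (fiberBasis r E x) (fiberBasis r E x)]
    intro m l
    rw [inner_curvEnd_fiberBasis, ← inner_conj_symm, inner_curvEnd_fiberBasis,
      ← conjTranspose_chernCurvature_mul (hh.contDiffAt x) (eventually_det_gram_ne_zero E x)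
        (Eventually.of_forall fun z => isHermitian_gram E x z) j k, conjTranspose_apply]
    exact star_star _
  rw [h, LinearMap.adjoint_inner_left]

/-- This is where the curvature of `det E` enters the matrix inequalities, as the trace of the
curvature of `E`. -/
theorem traceMatrix_curvEnd (hh : IsSmoothMetric n r E) (x : X) :
    traceMatrix (curvEnd (n := n) r E x) = of (detCurvCoeff r E x) := by
  ext j k
  rw [traceMatrix, of_apply, of_apply, detCurvCoeff,
    chernCurvature_det (hh.contDiffAt x) (eventually_det_gram_ne_zero E x), curvEnd,
    Matrix.trace_toLin_eq, trace_transpose]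

lemma nakanoPositive_iff (hh : IsSmoothMetric n r E) : NakanoPositive n r E ↔
    ∀ x, (nakanoMatrix (orthoFrame r E x) (curvEnd (n := n) r E x)).PosDef :=
  forall_congr' fun x =>
    (isHermitian_nakanoMatrix (inner_curvEnd hh x)).posDef_iff_re_sum_prod.symm

lemma dualNakanoPositive_iff (hh : IsSmoothMetric n r E) : DualNakanoPositive n r E ↔
    ∀ x, (dualNakanoMatrix (orthoFrame r E x) (curvEnd (n := n) r E x)).PosDef :=
  forall_congr' fun x =>
    (isHermitian_dualNakanoMatrix (inner_curvEnd hh x)).posDef_iff_re_sum_prod.symm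

lemma griffithsPositive_iff (hh : IsSmoothMetric n r E) : GriffithsPositive n r E ↔
    ∀ x (v : E x), v ≠ 0 → (quadMatrix (curvEnd (n := n) r E x) v).PosDef := by
  refine forall_congr' fun x => ?_
  simp only [(isHermitian_quadMatrix (inner_curvEnd hh x) _).posDef_iff_re_sum]
  exact ⟨fun h v hv ξ hξ => h ξ v hξ hv, fun h ξ v hξ hv => h v hv ξ hξ⟩

lemma detPositive_iff (hh : IsSmoothMetric n r E) : DetPositive n r E ↔
    ∀ x, (traceMatrix (curvEnd (n := n) r E x)).PosDef := by
  refine forall_congr' fun x => ?_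
  rw [(isHermitian_traceMatrix (inner_curvEnd hh x) (orthoFrame r E x)).posDef_iff_re_sum,
    traceMatrix_curvEnd hh]
  rfl

lemma projectivelyFlat_iff (hr : 0 < r) : ProjectivelyFlat n r E ↔
    ∀ x, IsScalarCurvature r (curvEnd (n := n) r E x) :=
  ⟨fun ⟨_, ha⟩ x => isScalarCurvature_of_eq_smul hr (orthoFrame r E x) (ha x),
    fun h => ⟨_, h⟩⟩

/-- The factor `n!` cancels against the one in the top power, and `r⁻ⁿ` is absorbed into the `n × n`
determinant, which is real because the matrix is hermitian. -/
lemma detVolume_eq (hr : 0 < r) (hh : IsSmoothMetric n r E) (x : X) : detVolume n r E x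
    = ((((r : ℂ)⁻¹ • traceMatrix (curvEnd (n := n) r E x)).det.re : ℝ) : ℂ)
      • coordVol (n := n) x := by
  have h1 : (((r : ℂ)⁻¹ • traceMatrix (curvEnd (n := n) r E x)).det.re : ℂ)
      = ((r : ℂ)⁻¹ • traceMatrix (curvEnd (n := n) r E x)).det := by
    have hT := isHermitian_traceMatrix (inner_curvEnd hh x) (orthoFrame r E x)
    have hS : ((r : ℂ)⁻¹ • traceMatrix (curvEnd (n := n) r E x)).IsHermitian := by
      rw [IsHermitian, conjTranspose_smul, hT.eq]
      simp
    exact hS.coe_re_det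
  rw [h1, detVolume, detCurv]
  erw [form11_pow x (of (detCurvCoeff r E x))]
  rw [smul_smul, traceMatrix_curvEnd hh, det_smul, Fintype.card_fin]
  congr 1
  have h2 : (n.factorial : ℂ) ≠ 0 := by exact_mod_cast n.factorial_ne_zero
  have h3 : (r : ℂ) ≠ 0 := by exact_mod_cast hr.ne'
  rw [inv_pow]
  field_simp

lemma PhiN_eq (x : X) : PhiN n r E x
    = (((nakanoMatrix (orthoFrame r E x) (curvEnd (n := n) r E x)).det.re ^ (1 / (r : ℝ)) : ℝ) : ℂ)
      • coordVol (n := n) x := rfl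

lemma PhiNdual_eq (x : X) : PhiNdual n r E x
    = (((dualNakanoMatrix (orthoFrame r E x) (curvEnd (n := n) r E x)).det.re ^ (1 / (r : ℝ)) : ℝ)
      : ℂ) • coordVol (n := n) x := rfl

lemma PhiG_eq (hh : IsSmoothMetric n r E) (x : X) : PhiG n r E x
    = ((sInf (unitDets (curvEnd (n := n) r E x)) : ℝ) : ℂ) • coordVol (n := n) x := by
  rw [PhiG]
  congr 3
  ext t
  refine exists_congr fun v => and_congr_right fun _ => ?_
  have h2 : (n.factorial : ℂ) ≠ 0 := by exact_mod_cast n.factorial_ne_zero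
  have hS := isHermitian_quadMatrix (inner_curvEnd hh x) v
  have h1 : ((quadMatrix (curvEnd (n := n) r E x) v).det.re : ℂ)
      = (quadMatrix (curvEnd (n := n) r E x) v).det := hS.coe_re_det
  have h3 : form11 (n := n) x (curvOn r E x v) ^ n
      = ((n.factorial : ℂ) * (quadMatrix (curvEnd (n := n) r E x) v).det) • coordVol (n := n) x :=
    form11_pow x (quadMatrix (curvEnd (n := n) r E x) v)
  rw [h3, smul_smul, smul_coordVol_inj, one_div, inv_mul_cancel_left₀ h2, ← h1]
  exact Complex.ofReal_inj

end Gram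

end ChernForms

theorem proposition2p5 {n r : ℕ} (hr : 0 < r)
    {X : Type*} [TopologicalSpace X] [ChartedSpace (Cn n) X]
    [IsManifold 𝓘(ℂ, Cn n) ω X]
    (E : X → Type*) [TopologicalSpace (TotalSpace (Cn r) E)]
    [∀ x, NormedAddCommGroup (E x)] [∀ x, InnerProductSpace ℂ (E x)]
    [FiberBundle (Cn r) E] [VectorBundle ℂ (Cn r) E]
    [ContMDiffVectorBundle ω (Cn r) E 𝓘(ℂ, Cn n)]
    (hh : IsSmoothMetric n r E) :
    -- (a) Nakano positivity
    ((NakanoPositive n r E →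
        ∀ x, VolLE x (PhiN n r E x) (detVolume n r E x)) ∧
      ((NakanoPositive n r E ∧
          ∀ x, PhiN n r E x = detVolume n r E x) ↔
        ProjectivelyFlat n r E ∧ DetPositive n r E)) ∧
    -- (b) dual Nakano positivity
    ((DualNakanoPositive n r E →
        ∀ x, VolLE x (PhiNdual n r E x) (detVolume n r E x)) ∧
      ((DualNakanoPositive n r E ∧
          ∀ x, PhiNdual n r E x = detVolume n r E x) ↔
        ProjectivelyFlat n r E ∧ DetPositive n r E)) ∧
    -- (c) Griffiths positivity
    ((GriffithsPositive n r E →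
        ∀ x, VolLE x (PhiG n r E x) (detVolume n r E x)) ∧
      ((GriffithsPositive n r E ∧
          ∀ x, PhiG n r E x = detVolume n r E x) ↔
        ProjectivelyFlat n r E ∧ DetPositive n r E)) := by
  have hflat := projectivelyFlat_iff (n := n) (E := E) hr
  have hdet := detPositive_iff hh
  refine ⟨⟨fun h x => ?_, ?_⟩, ⟨fun h x => ?_, ?_⟩, fun h x => ?_, ?_⟩
  · have hC := (nakanoPositive_iff hh).1 h x
    have := hC.rpow_re_det_le hr
    rw [partialTrace_nakanoMatrix] at this
    rw [PhiN_eq, detVolume_eq hr hh]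
    exact volLE_smul_coordVol x this
  -- Every condition is now a statement for each `x`, so the equivalence reduces to a single point.
  · rw [nakanoPositive_iff hh, hflat, hdet, ← forall_and, ← forall_and]
    refine forall_congr' fun x => ?_
    rw [isScalarCurvature_iff_nakanoMatrix (u := orthoFrame r E x),
      ← partialTrace_nakanoMatrix (u := orthoFrame r E x),
      ← Matrix.posDef_and_rpow_re_det_eq_iff hr, PhiN_eq, detVolume_eq hr hh, smul_coordVol_inj,
      Complex.ofReal_inj, partialTrace_nakanoMatrix]
  · have hC := (dualNakanoPositive_iff hh).1 h x
    have := hC.rpow_re_det_le hr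
    rw [partialTrace_dualNakanoMatrix] at this
    rw [PhiNdual_eq, detVolume_eq hr hh]
    exact volLE_smul_coordVol x this
  · rw [dualNakanoPositive_iff hh, hflat, hdet, ← forall_and, ← forall_and]
    refine forall_congr' fun x => ?_
    rw [isScalarCurvature_iff_dualNakanoMatrix (u := orthoFrame r E x),
      ← partialTrace_dualNakanoMatrix (u := orthoFrame r E x),
      ← Matrix.posDef_and_rpow_re_det_eq_iff hr, PhiNdual_eq, detVolume_eq hr hh, smul_coordVol_inj,
      Complex.ofReal_inj, partialTrace_dualNakanoMatrix]
  · rw [PhiG_eq hh, detVolume_eq hr hh]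
    exact volLE_smul_coordVol x
      (sInf_unitDets_le hr (orthoFrame r E x) ((griffithsPositive_iff hh).1 h x))
  · rw [griffithsPositive_iff hh, hflat, hdet, ← forall_and, ← forall_and]
    refine forall_congr' fun x => ?_
    rw [← posDef_and_sInf_unitDets_eq_iff hr (orthoFrame r E x), PhiG_eq hh, detVolume_eq hr hh,
      smul_coordVol_inj, Complex.ofReal_inj]
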